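/- Let $n\ge 2$, let $\mathbf T^n=(\mathbf R/\mathbf Z)^n$, let $\Gamma\subset\mathbf T^n$ be a compact set with Hausdorff dimension $\dim_{\mathcal H}\Gamma<1$, and let $Y=\mathbf T^n\setminus\Gamma$ (an oriented open subset of $\mathbf T^n$). Let $Z$ be an oriented $n$-dimensional manifold without boundary (topological, Hausdorff and second countable; it need be neither smooth nor connected, and it may be non-compact, so every oriented open manifold is allowed), and suppose that there is a proper continuous map $f\colon Z\to Y$ of non-zero degree. Then $Z$ is open SYS. More precisely, there are classes $\alpha_1,\dots,\alpha_{n-2}\in H^1(\mathbf T^n;\mathbf Z)$ such that, with $j\colon Y\to\mathbf T^n$ the inclusion and $\beta_i=(j\circ f)^*\alpha_i\in H^1(Z;\mathbf Z)$, the class $$[Z]\smallfrown\beta_1\smallfrown\cdots\smallfrown\beta_{n-2}\in H_2^{\mathrm{lf}}(Z)$$ is aspherical. Here homology is integral singular homology, and $H_k^{\mathrm{lf}}(M)=H_k\bigl(\varprojlim_{K}C_*(M,M\setminus K)\bigr)$, with $K$ running over the compact subsets of $M$, is locally finite homology. An orientation of an $n$-manifold $M$ is a locally consistent choice of generators of the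 groups $H_n(M,M\setminus\{x\})$, $x\in M$, and the fundamental class $[M]\in H_n^{\mathrm{lf}}(M)$ is the class that restricts to the chosen generator at every point $x$. A proper map $f\colon Z\to Y$ has degree $d\in\mathbf Z$ if $f_*[Z]=d\,[Y]$ in $H_n^{\mathrm{lf}}(Y)$. A class $\tau\in H_2^{\mathrm{lf}}(M)$ is aspherical if there is an open set $\Omega\subset M$ with compact closure such that the restriction $\tau|_\Omega\in H_2(M,M\setminus\Omega)$ does not lie in the Hurewicz image of $\pi_2(M,M\setminus\Omega)$, for any base point; that is, $\tau|_\Omega$ is represented neither by a map $(D^2,S^1)\to(M,M\setminus\Omega)$ nor by a map $S^2\to M$. An oriented $n$-manifold $M$ is open SYS if there are $\beta_1,\dots,\beta_{n-2}\in H^1(M;\mathbf Z)$ such that $[M]\smallfrown\beta_1\smallfrown\cdots\smallfrown\beta_{n-2}$ is aspherical. -/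

import Mathlib

open TopologicalSpace

namespace SYS

noncomputable section

/-! ### Singular chains with integer coefficients -/

/-- Singular `k`-simplices of `X`: continuous maps from the standard `k`-simplex. -/
abbrev Simplex (X : Type*) [TopologicalSpace X] (k : ℕ) : Type _ :=
  C(stdSimplex ℝ (Fin (k + 1)), X)

/-- Singular chains with integer coefficients. -/
abbrev Chain (X : Type*) [TopologicalSpace X] (k : ℕ) : Type _ :=
  Simplex X k →₀ ℤ

/-- Singular cochains with integer coefficients. -/
abbrev Cochain (X : Type*) [TopologicalSpace X] (k : ℕ) : Type _ :=
  Simplex X k → ℤ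

section Simplices

variable {X : Type*} [TopologicalSpace X]

/-- The singular simplex `σ|[v_{f 0}, …, v_{f l}]`. -/
def Simplex.pull {k l : ℕ} (f : Fin (l + 1) → Fin (k + 1)) (σ : Simplex X k) : Simplex X l :=
  σ.comp ⟨stdSimplex.map f, stdSimplex.continuous_map f⟩

/-- The `i`-th face of a singular simplex (the vertex `v_i` is omitted). -/
def Simplex.face {k : ℕ} (i : Fin (k + 2)) (σ : Simplex X (k + 1)) : Simplex X k :=
  Simplex.pull i.succAbove σ

/-- The initial edge `σ|[v_0, v_1]`. -/
def Simplex.edge {k : ℕ} (σ : Simplex X (k + 1)) : Simplex X 1 :=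
  Simplex.pull (Fin.castLE (by omega)) σ

/-- The initial vertex `σ|[v_0]`. -/
def Simplex.vertex {k : ℕ} (σ : Simplex X k) : Simplex X 0 :=
  Simplex.pull (fun _ => 0) σ

theorem Simplex.pull_pull {k l m : ℕ} (f : Fin (l + 1) → Fin (k + 1))
    (g : Fin (m + 1) → Fin (l + 1)) (σ : Simplex X k) :
    Simplex.pull g (Simplex.pull f σ) = Simplex.pull (f ∘ g) σ := by
  ext t
  simp [Simplex.pull, stdSimplex.map_comp_apply]

theorem Simplex.range_pull {k l : ℕ} (f : Fin (l + 1) → Fin (k + 1)) (σ : Simplex X k) :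
    Set.range (Simplex.pull f σ) ⊆ Set.range σ := by
  rintro _ ⟨t, rfl⟩
  exact ⟨_, rfl⟩

end Simplices

/-- The additive map on singular chains with prescribed values on singular simplices. -/
def chainLift {X : Type*} [TopologicalSpace X] {M : Type*} [AddCommGroup M] {k : ℕ}
    (v : Simplex X k → M) : Chain X k →+ M :=
  Finsupp.liftAddHom fun σ => zmultiplesHom M (v σ)

theorem chainLift_single {X : Type*} [TopologicalSpace X] {M : Type*} [AddCommGroup M] {k : ℕ}
    (v : Simplex X k → M) (σ : Simplex X k) : chainLift v (Finsupp.single σ 1) = v σ := by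
  simp [chainLift]

theorem chain_hom_ext {X : Type*} [TopologicalSpace X] {M : Type*} [AddCommGroup M] {k : ℕ}
    {φ ψ : Chain X k →+ M}
    (h : ∀ σ, φ (Finsupp.single σ 1) = ψ (Finsupp.single σ 1)) : φ = ψ := by
  refine Finsupp.addHom_ext' fun σ => AddMonoidHom.ext_int ?_
  exact h σ

variable (X : Type*) [TopologicalSpace X]

/-- The singular boundary operator `∂ : C_{k+1}(X) → C_k(X)`. -/
def boundary (k : ℕ) : Chain X (k + 1) →+ Chain X k :=
  chainLift fun σ : Simplex X (k + 1) =>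
    ∑ i : Fin (k + 2), ((-1 : ℤ) ^ (i : ℕ)) • Finsupp.single (Simplex.face i σ) (1 : ℤ)

/-- The singular coboundary operator `δ : C^k(X) → C^{k+1}(X)`. -/
def coboundary (k : ℕ) : Cochain X k →+ Cochain X (k + 1) where
  toFun b := fun σ => ∑ i : Fin (k + 2), ((-1 : ℤ) ^ (i : ℕ)) * b (Simplex.face i σ)
  map_zero' := by
    funext σ
    simp
  map_add' b c := by
    funext σ
    simp [mul_add, Finset.sum_add_distrib]

/-- Integral singular `1`-cocycles. -/
def Cocycle1 : AddSubgroup (Cochain X 1) := (coboundary X 1).ker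

/-- The integral singular cohomology group `H¹(X)`. -/
abbrev H1 : Type _ :=
  Cocycle1 X ⧸ (coboundary X 0).range.addSubgroupOf (Cocycle1 X)

/-! ### Homology of a graded module with a boundary operator -/

section Homology

variable {C : ℕ → Type*} [∀ k, AddCommGroup (C k)]
variable {C' : ℕ → Type*} [∀ k, AddCommGroup (C' k)]

/-- The cycles of degree `k`; everything of degree `0` is a cycle. -/
def cycles (d : ∀ k, C (k + 1) →+ C k) : ∀ k, AddSubgroup (C k)
  | 0 => ⊤
  | k + 1 => (d k).ker

/-- Cycles of degree `k` modulo boundaries. -/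
def Homology (d : ∀ k, C (k + 1) →+ C k) (k : ℕ) : Type _ :=
  cycles d k ⧸ (d k).range.addSubgroupOf (cycles d k)

instance (d : ∀ k, C (k + 1) →+ C k) (k : ℕ) : AddCommGroup (Homology d k) :=
  inferInstanceAs (AddCommGroup (cycles d k ⧸ (d k).range.addSubgroupOf (cycles d k)))

/-- The homology class of a cycle. -/
def Homology.mk (d : ∀ k, C (k + 1) →+ C k) (k : ℕ) : cycles d k →+ Homology d k :=
  QuotientAddGroup.mk' _

theorem Homology.mk_surjective (d : ∀ k, C (k + 1) →+ C k) (k : ℕ) :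
    Function.Surjective (Homology.mk d k) :=
  QuotientAddGroup.mk_surjective

theorem Homology.mk_eq_zero_iff (d : ∀ k, C (k + 1) →+ C k) (k : ℕ) (z : cycles d k) :
    Homology.mk d k z = 0 ↔ ∃ c, d k c = z.1 :=
  QuotientAddGroup.eq_zero_iff z

/-- The map in homology induced by an additive map that sends cycles to cycles and boundaries to
boundaries. -/
def Homology.map {d : ∀ k, C (k + 1) →+ C k} {d' : ∀ k, C' (k + 1) →+ C' k} {p q : ℕ}
    (φ : C p →+ C' q) (hZ : ∀ c ∈ cycles d p, φ c ∈ cycles d' q)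
    (hB : ∀ c, φ (d p c) ∈ (d' q).range) : Homology d p →+ Homology d' q :=
  QuotientAddGroup.map _ _ ((φ.comp (cycles d p).subtype).codRestrict (cycles d' q)
    fun c => hZ c.1 c.2) (by
      rintro ⟨z, hz⟩ ⟨c, hc⟩
      obtain rfl : d p c = z := hc
      exact hB c)

/-- The map in homology induced by a chain map. -/
def Homology.mapChain {d : ∀ k, C (k + 1) →+ C k} {d' : ∀ k, C' (k + 1) →+ C' k}
    (φ : ∀ k, C k →+ C' k) (h : ∀ k c, d' k (φ (k + 1) c) = φ k (d k c)) (k : ℕ) :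
    Homology d k →+ Homology d' k :=
  Homology.map (φ k)
    (by
      cases k with
      | zero => exact fun c _ => AddSubgroup.mem_top _
      | succ k =>
        intro c hc
        have hc' : d k c = 0 := hc
        change d' k (φ (k + 1) c) = 0
        rw [h, hc', map_zero])
    (fun c => ⟨φ (k + 1) c, h k c⟩)

end Homology

/-! ### Relative homology -/

variable {X}

/-- The subgroup `C_k(A)` of `C_k(X)`, for a subset `A` of `X`. -/
def subChain (A : Set X) (k : ℕ) : AddSubgroup (Chain X k) where
  carrier := {c | ∀ σ : Simplex X k, c σ ≠ 0 → Set.range σ ⊆ A}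
  zero_mem' := fun σ h => absurd rfl h
  add_mem' {a b} ha hb σ h := by
    by_cases h' : a σ = 0
    · exact hb σ (by simpa [h'] using h)
    · exact ha σ h'
  neg_mem' {a} ha σ h := ha σ (by simpa using h)

/-- The relative chains `C_k(X, A) = C_k(X) / C_k(A)`. -/
def RelChain (A : Set X) (k : ℕ) : Type _ := Chain X k ⧸ subChain A k

instance (A : Set X) (k : ℕ) : AddCommGroup (RelChain A k) :=
  inferInstanceAs (AddCommGroup (Chain X k ⧸ subChain A k))

/-- The projection `C_k(X) → C_k(X, A)`. -/
def RelChain.mk (A : Set X) (k : ℕ) : Chain X k →+ RelChain A k :=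
  QuotientAddGroup.mk' _

theorem RelChain.mk_surjective (A : Set X) (k : ℕ) : Function.Surjective (RelChain.mk A k) :=
  QuotientAddGroup.mk_surjective

theorem subChain_mono {A B : Set X} (h : A ⊆ B) (k : ℕ) : subChain A k ≤ subChain B k :=
  fun _ hc σ hσ => (hc σ hσ).trans h

/-- To check that an additive map sends `C_p(A)` into a subgroup, it suffices to look at
simplices. -/
theorem subChain_le_comap {M : Type*} [AddCommGroup M] (A : Set X) {p : ℕ}
    (φ : Chain X p →+ M) (S : AddSubgroup M)
    (h : ∀ σ : Simplex X p, Set.range σ ⊆ A → φ (Finsupp.single σ 1) ∈ S) :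
    subChain A p ≤ S.comap φ := by
  intro c hc
  rw [← c.sum_single]
  refine AddSubgroup.sum_mem _ fun σ hσ => ?_
  have h1 := h σ (hc σ (Finsupp.mem_support_iff.mp hσ))
  have h2 : Finsupp.single σ (c σ) = c σ • Finsupp.single σ (1 : ℤ) := by simp
  rw [h2]
  exact AddSubgroup.zsmul_mem (S.comap φ) h1 _

theorem single_mem_subChain {A : Set X} {k : ℕ} {σ : Simplex X k} (h : Set.range σ ⊆ A) (a : ℤ) :
    Finsupp.single σ a ∈ subChain A k := by
  intro τ hτ
  obtain rfl : σ = τ := by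
    by_contra hne
    exact hτ (Finsupp.single_eq_of_ne (Ne.symm hne))
  exact h

theorem boundary_single {k : ℕ} (σ : Simplex X (k + 1)) :
    boundary X k (Finsupp.single σ 1) =
      ∑ i : Fin (k + 2), ((-1 : ℤ) ^ (i : ℕ)) • Finsupp.single (Simplex.face i σ) (1 : ℤ) := by
  exact chainLift_single _ σ

/-- The boundary operator of `C_*(X, A)`. -/
def relBoundary (A : Set X) (k : ℕ) : RelChain A (k + 1) →+ RelChain A k :=
  QuotientAddGroup.map _ _ (boundary X k) (subChain_le_comap A _ _ fun σ hσ => by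
    rw [boundary_single]
    exact AddSubgroup.sum_mem _ fun i _ => AddSubgroup.zsmul_mem _
      (single_mem_subChain ((Simplex.range_pull _ σ).trans hσ) 1) _)

/-- The relative singular homology group `H_k(X, A)`. -/
abbrev RelHomology (A : Set X) (k : ℕ) : Type _ := Homology (relBoundary A) k

/-- The quotient map `C_k(X, A) → C_k(X, B)` for `A ⊆ B`. -/
def relFactor {A B : Set X} (h : A ⊆ B) (k : ℕ) : RelChain A k →+ RelChain B k :=
  QuotientAddGroup.map _ _ (AddMonoidHom.id _) (subChain_mono h k)

theorem relFactor_boundary {A B : Set X} (h : A ⊆ B) (k : ℕ) (c : RelChain A (k + 1)) :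
    relBoundary B k (relFactor h (k + 1) c) = relFactor h k (relBoundary A k c) := by
  obtain ⟨c, rfl⟩ := RelChain.mk_surjective _ _ c
  rfl

/-- The map `H_k(X, A) → H_k(X, B)` for `A ⊆ B`. -/
def RelHomology.factor {A B : Set X} (h : A ⊆ B) (k : ℕ) :
    RelHomology A k →+ RelHomology B k :=
  Homology.mapChain (relFactor h) (relFactor_boundary h) k

/-! ### Locally finite homology -/

variable (X)

/-- The inverse limit of `C_k(X, X \ K)` over the compact subsets `K` of `X`: families of relative
chains, one for each `K`, that are compatible with the projections for `K ⊆ L`. -/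
def LFChain (k : ℕ) : AddSubgroup (∀ K : Compacts X, RelChain ((K : Set X)ᶜ) k) where
  carrier := {c | ∀ (K L : Compacts X) (h : (K : Set X) ⊆ L),
    relFactor (Set.compl_subset_compl.mpr h) k (c L) = c K}
  add_mem' {a b} ha hb K L h := by simp [ha K L h, hb K L h]
  zero_mem' K L h := by simp
  neg_mem' {a} ha K L h := by simp [ha K L h]

variable {X}
variable {Y : Type*} [TopologicalSpace Y]

/-- A map of inverse limits given by maps `C_p(X, X \ e L) → C_q(Y, Y \ L)`, where `e` sends
compact subsets of `Y` to compact subsets of `X`. -/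
def LFChain.map {p q : ℕ} (e : Compacts Y → Compacts X)
    (he : ∀ K L : Compacts Y, (K : Set Y) ⊆ L → (e K : Set X) ⊆ e L)
    (φ : ∀ L : Compacts Y, RelChain ((e L : Set X)ᶜ) p →+ RelChain ((L : Set Y)ᶜ) q)
    (hφ : ∀ (K L : Compacts Y) (h : (K : Set Y) ⊆ L) (c : RelChain ((e L : Set X)ᶜ) p),
      relFactor (Set.compl_subset_compl.mpr h) q (φ L c) =
        φ K (relFactor (Set.compl_subset_compl.mpr (he K L h)) p c)) :
    LFChain X p →+ LFChain Y q where
  toFun c := ⟨fun L => φ L (c.1 (e L)), fun K L h => by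
    rw [hφ K L h, c.2 (e K) (e L) (he K L h)]⟩
  map_zero' := by
    refine Subtype.ext (funext fun L => ?_)
    simp
  map_add' a b := by
    refine Subtype.ext (funext fun L => ?_)
    simp

variable (X) in
/-- The boundary operator of the complex of locally finite chains. -/
def lfBoundary (k : ℕ) : LFChain X (k + 1) →+ LFChain X k :=
  LFChain.map id (fun _ _ h => h) (fun K => relBoundary ((K : Set X)ᶜ) k)
    (fun _ _ h c => (relFactor_boundary (Set.compl_subset_compl.mpr h) k c).symm)

variable (X) in
/-- The locally finite homology group `H_k^lf(X) = H_k(X, ∂_∞ X)`. -/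
abbrev LFHomology (k : ℕ) : Type _ := Homology (C := fun k => LFChain X k) (lfBoundary X) k

/-- The restriction `H_k^lf(X) → H_k(X, X \ W)`, `τ ↦ τ|_W`, for a set `W` contained in a compact
set `K`: the projection of the inverse limit to `C_k(X, X \ K)`, followed by
`C_k(X, X \ K) → C_k(X, X \ W)`. -/
def LFHomology.restrict (K : Compacts X) (W : Set X) (h : W ⊆ K) (k : ℕ) :
    LFHomology X k →+ RelHomology Wᶜ k :=
  Homology.mapChain
    (fun k => (relFactor (Set.compl_subset_compl.mpr h) k).comp
      ((Pi.evalAddMonoidHom _ K).comp (LFChain X k).subtype))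
    (fun k c => relFactor_boundary (Set.compl_subset_compl.mpr h) k (c.1 K)) k

/-- Push-forward of chains along a continuous map. -/
def chainMap (f : C(X, Y)) (k : ℕ) : Chain X k →+ Chain Y k :=
  chainLift fun σ : Simplex X k => Finsupp.single (f.comp σ) (1 : ℤ)

theorem chainMap_single (f : C(X, Y)) {k : ℕ} (σ : Simplex X k) :
    chainMap f k (Finsupp.single σ 1) = Finsupp.single (f.comp σ) 1 :=
  chainLift_single _ σ

theorem chainMap_boundary (f : C(X, Y)) (k : ℕ) (c : Chain X (k + 1)) :
    boundary Y k (chainMap f (k + 1) c) = chainMap f k (boundary X k c) := by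
  suffices h : (boundary Y k).comp (chainMap f (k + 1)) = (chainMap f k).comp (boundary X k) from
    DFunLike.congr_fun h c
  refine chain_hom_ext fun σ => ?_
  simp only [AddMonoidHom.comp_apply, chainMap_single, boundary_single, map_sum, map_zsmul]
  rfl

/-- Push-forward `C_k(X, A) → C_k(Y, B)` along a continuous map with `f(A) ⊆ B`. -/
def relMap (f : C(X, Y)) {A : Set X} {B : Set Y} (h : Set.MapsTo f A B) (k : ℕ) :
    RelChain A k →+ RelChain B k :=
  QuotientAddGroup.map _ _ (chainMap f k) (subChain_le_comap A _ _ fun σ hσ => by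
    rw [chainMap_single]
    refine single_mem_subChain ?_ 1
    rintro _ ⟨t, rfl⟩
    exact h (hσ ⟨t, rfl⟩))

theorem relMap_relFactor (f : C(X, Y)) {A A' : Set X} {B B' : Set Y} (h : Set.MapsTo f A B)
    (h' : Set.MapsTo f A' B') (hA : A ⊆ A') (hB : B ⊆ B') (k : ℕ) (c : RelChain A k) :
    relFactor hB k (relMap f h k c) = relMap f h' k (relFactor hA k c) := by
  obtain ⟨c, rfl⟩ := RelChain.mk_surjective _ _ c
  rfl

theorem relMap_boundary (f : C(X, Y)) {A : Set X} {B : Set Y} (h : Set.MapsTo f A B) (k : ℕ)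
    (c : RelChain A (k + 1)) :
    relBoundary B k (relMap f h (k + 1) c) = relMap f h k (relBoundary A k c) := by
  obtain ⟨c, rfl⟩ := RelChain.mk_surjective _ _ c
  exact congrArg (RelChain.mk B k) (chainMap_boundary f k c)

/-- The preimage of a compact set under a proper map. -/
def preimageCompacts (f : C(X, Y)) (hf : IsProperMap f) (L : Compacts Y) : Compacts X :=
  ⟨f ⁻¹' L, hf.isCompact_preimage L.isCompact⟩

theorem mapsTo_preimageCompacts (f : C(X, Y)) (hf : IsProperMap f) (L : Compacts Y) :
    Set.MapsTo f ((preimageCompacts f hf L : Set X)ᶜ) ((L : Set Y)ᶜ) :=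
  fun _ hx => hx

/-- Push-forward of locally finite chains along a proper map:
`C_k(X, X \ f⁻¹(L)) → C_k(Y, Y \ L)` for every compact subset `L` of `Y`. -/
def lfMap (f : C(X, Y)) (hf : IsProperMap f) (k : ℕ) : LFChain X k →+ LFChain Y k :=
  LFChain.map (preimageCompacts f hf) (fun _ _ h _ hx => h hx)
    (fun L => relMap f (mapsTo_preimageCompacts f hf L) k)
    (fun _ _ _ c => relMap_relFactor f _ _ _ _ k c)

/-- Push-forward `f_* : H_k^lf(X) → H_k^lf(Y)` along a proper map. -/
def LFHomology.map (f : C(X, Y)) (hf : IsProperMap f) (k : ℕ) :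
    LFHomology X k →+ LFHomology Y k :=
  Homology.mapChain (lfMap f hf)
    (fun k c => by
      refine Subtype.ext (funext fun L => ?_)
      exact relMap_boundary f _ k (c.1 _)) k

/-- The pull-back `f^* : H¹(Y) → H¹(X)`. -/
def H1.map (f : C(X, Y)) : H1 Y →+ H1 X :=
  QuotientAddGroup.map _ _
    { toFun := fun b => ⟨fun σ => b.1 (f.comp σ), by
        funext σ
        exact congrFun (show coboundary Y 1 b.1 = 0 from b.2) (f.comp σ)⟩
      map_zero' := rfl
      map_add' := fun _ _ => rfl }
    (by
      rintro ⟨b, hb⟩ ⟨g, hg⟩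
      obtain rfl : coboundary Y 0 g = b := hg
      exact ⟨fun σ => g (f.comp σ), rfl⟩)

/-! ### Cap product with classes in `H¹` -/

/-- The cap product with a `1`-cochain, `σ ⌢ b = b(σ|[v_0, v_1]) σ|[v_1, …, v_{k+1}]`. -/
def capChain (k : ℕ) (b : Cochain X 1) : Chain X (k + 1) →+ Chain X k :=
  chainLift fun σ : Simplex X (k + 1) =>
    b (Simplex.edge σ) • Finsupp.single (Simplex.face 0 σ) (1 : ℤ)

/-- The cap product with a `0`-cochain, `σ ⌢ g = g(σ|[v_0]) σ`. -/
def capChain0 (k : ℕ) (g : Cochain X 0) : Chain X k →+ Chain X k :=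
  chainLift fun σ : Simplex X k =>
    g (Simplex.vertex σ) • Finsupp.single σ (1 : ℤ)

theorem capChain_single {k : ℕ} (b : Cochain X 1) (σ : Simplex X (k + 1)) :
    capChain k b (Finsupp.single σ 1) =
      b (Simplex.edge σ) • Finsupp.single (Simplex.face 0 σ) (1 : ℤ) := by
  exact chainLift_single _ σ

theorem capChain0_single {k : ℕ} (g : Cochain X 0) (σ : Simplex X k) :
    capChain0 k g (Finsupp.single σ 1) = g (Simplex.vertex σ) • Finsupp.single σ (1 : ℤ) := by
  exact chainLift_single _ σ

theorem Simplex.face_face {k : ℕ} (σ : Simplex X (k + 2)) (i : Fin (k + 2)) :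
    Simplex.face 0 (Simplex.face i.succ σ) = Simplex.face i (Simplex.face 0 σ) := by
  simp only [Simplex.face, Simplex.pull_pull]
  congr 1
  funext t
  simp

theorem Simplex.edge_face {k : ℕ} (σ : Simplex X (k + 2)) (i : Fin (k + 1)) :
    Simplex.edge (Simplex.face i.succ.succ σ) = Simplex.edge σ := by
  simp only [Simplex.face, Simplex.edge, Simplex.pull_pull]
  congr 1
  funext t
  fin_cases t
  · rfl
  · simp [Fin.succAbove, Fin.lt_def]

theorem Simplex.vertex_face {k : ℕ} (σ : Simplex X (k + 1)) (i : Fin (k + 1)) :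
    Simplex.vertex (Simplex.face i.succ σ) = Simplex.vertex σ := by
  simp only [Simplex.face, Simplex.vertex, Simplex.pull_pull]
  congr 1

/-- `∂(c ⌢ b) = -(∂c ⌢ b)` for a `1`-cocycle `b`. -/
theorem boundary_capChain (k : ℕ) (b : Cochain X 1) (hb : b ∈ Cocycle1 X)
    (c : Chain X (k + 2)) :
    boundary X k (capChain (k + 1) b c) = -capChain k b (boundary X (k + 1) c) := by
  suffices h : (boundary X k).comp (capChain (k + 1) b) =
      -((capChain k b).comp (boundary X (k + 1))) from DFunLike.congr_fun h c
  refine chain_hom_ext fun σ => ?_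
  have hσ : ∑ i : Fin 3, (-1 : ℤ) ^ (i : ℕ) *
      b (Simplex.face i (Simplex.pull (Fin.castLE (by omega) : Fin 3 → Fin (k + 3)) σ)) = 0 :=
    congrFun (show coboundary X 1 b = 0 from hb) _
  have h0 : Simplex.face 0 (Simplex.pull (Fin.castLE (by omega) : Fin 3 → Fin (k + 3)) σ) =
      Simplex.edge (Simplex.face 0 σ) := by
    simp only [Simplex.face, Simplex.edge, Simplex.pull_pull]
    congr 1
  have h1 : Simplex.face 1 (Simplex.pull (Fin.castLE (by omega) : Fin 3 → Fin (k + 3)) σ) =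
      Simplex.edge (Simplex.face (Fin.succ 0) σ) := by
    simp only [Simplex.face, Simplex.edge, Simplex.pull_pull]
    congr 1
    funext t
    fin_cases t <;> simp [Fin.ext_iff, Fin.succAbove, Fin.lt_def]
  have h2 : Simplex.face 2 (Simplex.pull (Fin.castLE (by omega) : Fin 3 → Fin (k + 3)) σ) =
      Simplex.edge σ := by
    simp only [Simplex.face, Simplex.edge, Simplex.pull_pull]
    congr 1
    funext t
    fin_cases t <;> simp [Fin.ext_iff, Fin.succAbove, Fin.lt_def]
  simp only [Fin.sum_univ_three, h0, h1, h2] at hσ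
  have hb' : b (Simplex.edge (Simplex.face (Fin.succ 0) σ)) =
      b (Simplex.edge (Simplex.face 0 σ)) + b (Simplex.edge σ) := by
    simp at hσ
    simp
    linarith
  simp only [AddMonoidHom.comp_apply, AddMonoidHom.neg_apply, capChain_single, boundary_single,
    map_sum, map_zsmul]
  rw [Fin.sum_univ_succ (n := k + 2), Fin.sum_univ_succ (n := k + 1),
    Fin.sum_univ_succ (n := k + 1), hb']
  simp only [Simplex.face_face, Simplex.edge_face]
  have ht : ∀ i : ℕ, (-1 : ℤ) ^ (i + 1 + 1) = -(-1 : ℤ) ^ (i + 1) := fun i => by simp [pow_succ]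
  have h3 : Simplex.face 0 (Simplex.face (Fin.succ 0) σ) =
      Simplex.face 0 (Simplex.face 0 σ) := Simplex.face_face σ 0
  simp only [ht, Fin.val_zero, Fin.val_succ, pow_zero, zero_add, pow_one, one_smul, smul_add,
    add_smul, neg_smul, Finset.smul_sum, Finset.sum_neg_distrib,
    smul_comm (b (Simplex.edge σ))]
  abel

/-- `c ⌢ δg = ∂c ⌢ g - ∂(c ⌢ g)` for a `0`-cochain `g`. -/
theorem capChain_coboundary (k : ℕ) (g : Cochain X 0) (c : Chain X (k + 1)) :
    capChain k (coboundary X 0 g) c =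
      capChain0 k g (boundary X k c) - boundary X k (capChain0 (k + 1) g c) := by
  suffices h : capChain k (coboundary X 0 g) =
      (capChain0 k g).comp (boundary X k) - (boundary X k).comp (capChain0 (k + 1) g) from
    DFunLike.congr_fun h c
  refine chain_hom_ext fun σ => ?_
  have h0 : Simplex.face 0 (Simplex.edge σ) = Simplex.vertex (Simplex.face 0 σ) := by
    simp only [Simplex.face, Simplex.edge, Simplex.vertex, Simplex.pull_pull]
    congr 1
    funext t
    fin_cases t
    rfl
  have h1 : Simplex.face 1 (Simplex.edge σ) = Simplex.vertex σ := by
    simp only [Simplex.face, Simplex.edge, Simplex.vertex, Simplex.pull_pull]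
    congr 1
    funext t
    fin_cases t
    rfl
  have hg : coboundary X 0 g (Simplex.edge σ) =
      g (Simplex.vertex (Simplex.face 0 σ)) - g (Simplex.vertex σ) := by
    change ∑ i : Fin 2, (-1 : ℤ) ^ (i : ℕ) * g (Simplex.face i (Simplex.edge σ)) = _
    rw [Fin.sum_univ_two, h0, h1]
    simp [sub_eq_add_neg]
  simp only [AddMonoidHom.comp_apply, AddMonoidHom.sub_apply, capChain_single, capChain0_single,
    boundary_single, map_sum, map_zsmul, hg]
  rw [Fin.sum_univ_succ (n := k + 1), Fin.sum_univ_succ (n := k + 1)]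
  simp only [Simplex.vertex_face, Fin.val_zero, pow_zero, one_smul, smul_add, Finset.smul_sum,
    sub_smul, smul_comm (g (Simplex.vertex σ))]
  abel

/-- The cap product of relative chains with a `1`-cochain. -/
def relCap (A : Set X) (k : ℕ) (b : Cochain X 1) : RelChain A (k + 1) →+ RelChain A k :=
  QuotientAddGroup.map _ _ (capChain k b) (subChain_le_comap A _ _ fun σ hσ => by
    rw [capChain_single]
    exact AddSubgroup.zsmul_mem _ (single_mem_subChain ((Simplex.range_pull _ σ).trans hσ) 1) _)

/-- The cap product of relative chains with a `0`-cochain. -/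
def relCap0 (A : Set X) (k : ℕ) (g : Cochain X 0) : RelChain A k →+ RelChain A k :=
  QuotientAddGroup.map _ _ (capChain0 k g) (subChain_le_comap A _ _ fun σ hσ => by
    rw [capChain0_single]
    exact AddSubgroup.zsmul_mem _ (single_mem_subChain hσ 1) _)

/-- The cap product of locally finite chains with a `1`-cochain. -/
def lfCap (k : ℕ) (b : Cochain X 1) : LFChain X (k + 1) →+ LFChain X k :=
  LFChain.map id (fun _ _ h => h) (fun K => relCap ((K : Set X)ᶜ) k b)
    (fun _ _ _ c => by
      obtain ⟨c, rfl⟩ := RelChain.mk_surjective _ _ c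
      rfl)

/-- The cap product of locally finite chains with a `0`-cochain. -/
def lfCap0 (k : ℕ) (g : Cochain X 0) : LFChain X k →+ LFChain X k :=
  LFChain.map id (fun _ _ h => h) (fun K => relCap0 ((K : Set X)ᶜ) k g)
    (fun _ _ _ c => by
      obtain ⟨c, rfl⟩ := RelChain.mk_surjective _ _ c
      rfl)

theorem lfBoundary_lfCap (k : ℕ) (b : Cochain X 1) (hb : b ∈ Cocycle1 X)
    (c : LFChain X (k + 2)) :
    lfBoundary X k (lfCap (k + 1) b c) = -lfCap k b (lfBoundary X (k + 1) c) := by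
  refine Subtype.ext (funext fun K => ?_)
  obtain ⟨a, ha⟩ := RelChain.mk_surjective _ _ (c.1 K)
  change relBoundary _ k (relCap _ (k + 1) b (c.1 K)) =
    -relCap _ k b (relBoundary _ (k + 1) (c.1 K))
  rw [← ha]
  exact congrArg (RelChain.mk _ k)
    (boundary_capChain k b hb a)

theorem lfCap_coboundary (k : ℕ) (g : Cochain X 0) (c : LFChain X (k + 1)) :
    lfCap k (coboundary X 0 g) c =
      lfCap0 k g (lfBoundary X k c) - lfBoundary X k (lfCap0 (k + 1) g c) := by
  refine Subtype.ext (funext fun K => ?_)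
  obtain ⟨a, ha⟩ := RelChain.mk_surjective _ _ (c.1 K)
  change relCap _ k (coboundary X 0 g) (c.1 K) =
    relCap0 _ k g (relBoundary _ k (c.1 K)) - relBoundary _ k (relCap0 _ (k + 1) g (c.1 K))
  rw [← ha]
  exact congrArg (RelChain.mk _ k)
    (capChain_coboundary k g a)

theorem lfCap_add (k : ℕ) (b b' : Cochain X 1) (c : LFChain X (k + 1)) :
    lfCap k (b + b') c = lfCap k b c + lfCap k b' c := by
  have h : capChain k (b + b') = capChain k b + capChain k b' :=
    chain_hom_ext fun σ => by simp [capChain_single, add_smul]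
  refine Subtype.ext (funext fun K => ?_)
  obtain ⟨a, ha⟩ := RelChain.mk_surjective _ _ (c.1 K)
  change relCap _ k (b + b') (c.1 K) = relCap _ k b (c.1 K) + relCap _ k b' (c.1 K)
  rw [← ha]
  exact congrArg (RelChain.mk _ k)
    (DFunLike.congr_fun h a)

/-- The cap product `H_{k+1}^lf(X) → H_k^lf(X)` with a `1`-cocycle. -/
def capCocycle (k : ℕ) (b : Cocycle1 X) : LFHomology X (k + 1) →+ LFHomology X k :=
  Homology.map (lfCap k b.1)
    (by
      cases k with
      | zero => exact fun c _ => AddSubgroup.mem_top _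
      | succ k =>
        intro c hc
        have hc' : lfBoundary X (k + 1) c = 0 := hc
        change lfBoundary X k (lfCap (k + 1) b.1 c) = 0
        rw [lfBoundary_lfCap k b.1 b.2, hc', map_zero, neg_zero])
    (fun c => ⟨-lfCap (k + 1) b.1 c, by
      rw [map_neg, lfBoundary_lfCap k b.1 b.2, neg_neg]⟩)

/-- The cap product `H¹(X) → Hom(H_{k+1}^lf(X), H_k^lf(X))`, `β ↦ (τ ↦ τ ⌢ β)`. -/
def cap (k : ℕ) : H1 X →+ LFHomology X (k + 1) →+ LFHomology X k :=
  QuotientAddGroup.lift _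
    (AddMonoidHom.mk' (capCocycle k) fun b b' => by
      refine AddMonoidHom.ext fun τ => ?_
      obtain ⟨z, rfl⟩ := Homology.mk_surjective _ _ τ
      exact congrArg (Homology.mk _ _) (Subtype.ext (lfCap_add k b.1 b'.1 z.1)))
    (by
      rintro ⟨b, hb⟩ ⟨g, hg⟩
      obtain rfl : coboundary X 0 g = b := hg
      refine AddMonoidHom.ext fun τ => ?_
      obtain ⟨⟨c, hc⟩, rfl⟩ := Homology.mk_surjective _ _ τ
      have hc' : lfBoundary X k c = 0 := hc
      refine (Homology.mk_eq_zero_iff _ _ _).mpr ⟨-lfCap0 (k + 1) g c, ?_⟩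
      change lfBoundary X k (-lfCap0 (k + 1) g c) = lfCap k (coboundary X 0 g) c
      rw [lfCap_coboundary, hc', map_zero, map_neg, zero_sub])

/-- The iterated cap product `τ ⌢ β_0 ⌢ β_1 ⌢ ⋯ ⌢ β_{m-1}` in `H_2^lf(X)`, for `τ` in
`H_{m+2}^lf(X)`. -/
def iterCap : ∀ m : ℕ, LFHomology X (m + 2) → (Fin m → H1 X) → LFHomology X 2
  | 0, τ, _ => τ
  | m + 1, τ, β => iterCap m (cap (m + 2) (β 0) τ) (Fin.tail β)

/-! ### Aspherical classes -/

/-- The class `τ` in `H_k(X, A)` is represented by the chain `c` of `X`. -/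
def Represents {A : Set X} {k : ℕ} (c : Chain X k) (τ : RelHomology A k) : Prop :=
  ∃ h : RelChain.mk A k c ∈ cycles (relBoundary A) k, τ = Homology.mk (relBoundary A) k ⟨_, h⟩

/-- The topological boundary of the standard `2`-simplex. The pair `(Δ², ∂Δ²)` is a model of
`(D², S¹)`, and `Δ² / ∂Δ²` is a model of `S²`. -/
def diskBoundary : Set (stdSimplex ℝ (Fin 3)) := {t | ∃ i, t i = 0}

/-- The Hurewicz image of `π_2(X, A)` in `H_2(X, A)`, over all base points. An element of
`π_2(X, A, a)` is given by a map `σ : (Δ², ∂Δ²) → (X, A)`, and its Hurewicz image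
`σ_*[Δ², ∂Δ²]` is the class of the singular simplex `σ`. Elements of `π_2(X, x)` are included, also
if `A` is empty; they are given by maps `σ` that are constant on `∂Δ²` with value `x`, and their
Hurewicz image is the class of the cycle `σ - const_x`. -/
def hurewiczImage (A : Set X) : Set (RelHomology A 2) :=
  {τ | (∃ σ : Simplex X 2, Set.MapsTo σ diskBoundary A ∧ Represents (Finsupp.single σ 1) τ) ∨
    ∃ (σ : Simplex X 2) (x : X), (∀ t ∈ diskBoundary, σ t = x) ∧
      Represents (Finsupp.single σ 1 - Finsupp.single (ContinuousMap.const _ x) 1) τ}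

/-- A class `τ` in `H_2^lf(X)` is aspherical if for some open set `Ω` with compact closure, the
restriction `τ|_Ω` in `H_2(X, X \ Ω)` is not in the Hurewicz image of `π_2(X, X \ Ω)`. -/
def IsAspherical (τ : LFHomology X 2) : Prop :=
  ∃ (Ω : Set X) (_ : IsOpen Ω) (hc : IsCompact (closure Ω)),
    LFHomology.restrict ⟨closure Ω, hc⟩ Ω subset_closure 2 τ ∉ hurewiczImage Ωᶜ

/-! ### Orientations, fundamental classes, degree -/

variable (X) in
/-- An orientation of an `n`-manifold `X`: a choice of a generator of each local homology group
`H_n(X, X \ {x})` that is locally consistent. -/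
structure HomologyOrientation (n : ℕ) where
  gen : ∀ x : X, RelHomology ({x}ᶜ : Set X) n
  zmultiples_gen : ∀ x : X, AddSubgroup.zmultiples (gen x) = ⊤
  consistent : ∀ x : X, ∃ U : Set X, IsOpen U ∧ x ∈ U ∧ ∃ μ : RelHomology Uᶜ n,
    ∀ (y : X) (hy : y ∈ U),
      RelHomology.factor (Set.compl_subset_compl.mpr (Set.singleton_subset_iff.mpr hy)) n μ = gen y

/-- The fundamental class `[X]` in `H_n^lf(X)` of an oriented `n`-manifold: the class that restricts
to the given generator of `H_n(X, X \ {x})` for every point `x`. -/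
def IsFundamentalClass {n : ℕ} (o : HomologyOrientation X n) (μ : LFHomology X n) : Prop :=
  ∀ x : X, LFHomology.restrict {x} {x} subset_rfl n μ = o.gen x

/-- The proper map `f` between oriented `n`-manifolds has degree `d`: `f_*[X] = d [Y]`. -/
def HasDegree {n : ℕ} (oX : HomologyOrientation X n) (oY : HomologyOrientation Y n)
    (f : C(X, Y)) (hf : IsProperMap f) (d : ℤ) : Prop :=
  ∃ (μX : LFHomology X n) (μY : LFHomology Y n), IsFundamentalClass oX μX ∧
    IsFundamentalClass oY μY ∧ LFHomology.map f hf n μX = d • μY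

/-- The oriented `(m + 2)`-manifold `X` is open SYS: there are classes `β_1, …, β_m` in `H¹(X)` such
that `[X] ⌢ β_1 ⌢ ⋯ ⌢ β_m` is aspherical. -/
def IsOpenSYS {m : ℕ} (o : HomologyOrientation X (m + 2)) : Prop :=
  ∃ (μ : LFHomology X (m + 2)) (β : Fin m → H1 X),
    IsFundamentalClass o μ ∧ IsAspherical (iterCap m μ β)

end

end SYS

namespace SYS

noncomputable section

/-! ### Formal simplices with vertices in a type -/

/-! Write `n = m + 2`. Coordinate projections are Lipschitz, so each projects `Γ` to a compact set
of dimension `< 1`, which misses a point `t i` of the circle together with a neighbourhood. Hence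
`Γ` stays at distance more than some `ε` from all the walls `{y i = t i}` (`exists_walls`).

The cocycle `wallCochain t i` counts crossings of the `i`-th wall and is zero on every edge that
avoids it. The cup product `w` of all `n` wall cocycles therefore vanishes on chains away from the
walls, and the walls have a compact neighbourhood in `Γᶜ`, so `w` can be evaluated on locally finite
classes. Its value on `[Y]` is non-zero (`evalCup_wallCochain_ne_zero`): after subdivision `w` also
vanishes on chains that avoid the point `t` where the walls meet, so only the local class at `t`
matters, and a small cube around `t` has value 1. Hence `w` is non-zero on `f_*[Z] = d [Y]`.

Now cap `[Z]` with the pull-backs of the first `m` wall cocycles. The last two still have a non-zero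
cup product on the result (`LFRepresents.iterCap`). On the Hurewicz image relative to the complement
of a wall neighbourhood this product is zero: on one singular triangle it contains the value of a
wall cocycle on an edge of the boundary, and this edge avoids the wall or is constant
(`evalCup_eq_zero_of_mem_hurewiczImage`). So the capped class is aspherical. -/

/-- The additive map on a free abelian group with prescribed values on the basis. -/
def freeLift {ι M : Type*} [AddCommGroup M] (v : ι → M) : (ι →₀ ℤ) →+ M :=
  Finsupp.liftAddHom fun i => zmultiplesHom M (v i)

@[simp]
theorem freeLift_single {ι M : Type*} [AddCommGroup M] (v : ι → M) (i : ι) :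
    freeLift v (Finsupp.single i 1) = v i := by
  simp [freeLift]

theorem free_hom_ext {ι M : Type*} [AddCommGroup M] {φ ψ : (ι →₀ ℤ) →+ M}
    (h : ∀ i, φ (Finsupp.single i 1) = ψ (Finsupp.single i 1)) : φ = ψ :=
  Finsupp.addHom_ext' fun i => AddMonoidHom.ext_int (h i)

theorem freeLift_mem {ι M : Type*} [AddCommGroup M] {φ : (ι →₀ ℤ) →+ M} {S : AddSubgroup M}
    {c : ι →₀ ℤ} (h : ∀ i, c i ≠ 0 → φ (Finsupp.single i 1) ∈ S) : φ c ∈ S := by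
  have h' : c ∈ S.comap φ := by
    rw [← c.sum_single]
    refine AddSubgroup.sum_mem _ fun i hi => ?_
    have h2 : Finsupp.single i (c i) = c i • Finsupp.single i (1 : ℤ) := by simp
    rw [h2]
    exact AddSubgroup.zsmul_mem (S.comap φ) (h i (Finsupp.mem_support_iff.mp hi)) _
  exact h'

/-- Formal `l`-dimensional chains with vertices in `E`. -/
abbrev TupleChain (E : Type*) (l : ℕ) : Type _ := (Fin (l + 1) → E) →₀ ℤ

section Tuples

variable {E : Type*}

/-- The boundary of formal chains. -/
def tupleBoundary (l : ℕ) : TupleChain E (l + 1) →+ TupleChain E l :=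
  freeLift fun v => ∑ i : Fin (l + 2), ((-1 : ℤ) ^ (i : ℕ)) • Finsupp.single (v ∘ i.succAbove) (1 : ℤ)

theorem tupleBoundary_single {l : ℕ} (v : Fin (l + 2) → E) :
    tupleBoundary l (Finsupp.single v 1) =
      ∑ i : Fin (l + 2), ((-1 : ℤ) ^ (i : ℕ)) • Finsupp.single (v ∘ i.succAbove) (1 : ℤ) :=
  freeLift_single _ v

/-- The cone of formal chains with apex `b`. -/
def tupleCone (b : E) (l : ℕ) : TupleChain E l →+ TupleChain E (l + 1) :=
  freeLift fun v => Finsupp.single (Fin.cons b v : Fin (l + 2) → E) (1 : ℤ)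

theorem tupleCone_single (b : E) {l : ℕ} (v : Fin (l + 1) → E) :
    tupleCone b l (Finsupp.single v 1) = Finsupp.single (Fin.cons b v : Fin (l + 2) → E) 1 :=
  freeLift_single _ v

theorem cons_comp_succAbove_zero (b : E) {l : ℕ} (v : Fin (l + 1) → E) :
    (Fin.cons b v : Fin (l + 2) → E) ∘ (0 : Fin (l + 2)).succAbove = v := by
  funext t
  simp

theorem cons_comp_succAbove_succ (b : E) {l : ℕ} (v : Fin (l + 2) → E) (i : Fin (l + 2)) :
    (Fin.cons b v : Fin (l + 3) → E) ∘ i.succ.succAbove = Fin.cons b (v ∘ i.succAbove) := by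
  funext t
  refine Fin.cases ?_ (fun t => ?_) t <;> simp

theorem tupleBoundary_tupleCone (b : E) (l : ℕ) (c : TupleChain E (l + 1)) :
    tupleBoundary (l + 1) (tupleCone b (l + 1) c) = c - tupleCone b l (tupleBoundary l c) := by
  suffices h : (tupleBoundary (l + 1)).comp (tupleCone b (l + 1)) =
      AddMonoidHom.id _ - (tupleCone b l).comp (tupleBoundary l) from DFunLike.congr_fun h c
  refine free_hom_ext fun v => ?_
  simp only [AddMonoidHom.comp_apply, AddMonoidHom.sub_apply, AddMonoidHom.id_apply,
    tupleCone_single, tupleBoundary_single, map_sum, map_zsmul]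
  rw [Fin.sum_univ_succ]
  simp only [cons_comp_succAbove_zero, cons_comp_succAbove_succ, Fin.val_zero, pow_zero, one_smul,
    Fin.val_succ, pow_succ, mul_neg, mul_one, neg_smul, Finset.sum_neg_distrib, sub_eq_add_neg]

/-- In degree 0 the cone formula has an extra term, the apex counted with the augmentation of `c`.
It disappears when `c` is a boundary. -/
theorem tupleBoundary_tupleCone_zero (b : E) (c : TupleChain E 0) :
    tupleBoundary 0 (tupleCone b 0 c) =
      c - freeLift (fun _ => Finsupp.single (fun _ => b) (1 : ℤ)) c := by
  suffices h : (tupleBoundary 0).comp (tupleCone b 0) =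
      AddMonoidHom.id _ - freeLift (fun _ => Finsupp.single (fun _ => b) (1 : ℤ)) from
    DFunLike.congr_fun h c
  refine free_hom_ext fun v => ?_
  have h1 : (Fin.cons b v : Fin 2 → E) ∘ (1 : Fin 2).succAbove = fun _ => b := by
    funext t
    fin_cases t
    rfl
  simp only [AddMonoidHom.comp_apply, AddMonoidHom.sub_apply, AddMonoidHom.id_apply,
    tupleCone_single, tupleBoundary_single, freeLift_single]
  rw [Fin.sum_univ_two, h1, cons_comp_succAbove_zero]
  simp [sub_eq_add_neg]

theorem augmentation_tupleBoundary (b : E) (c : TupleChain E 1) :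
    freeLift (fun _ => Finsupp.single (fun _ : Fin 1 => b) (1 : ℤ)) (tupleBoundary 0 c) = 0 := by
  suffices h : (freeLift (fun _ => Finsupp.single (fun _ : Fin 1 => b) (1 : ℤ))).comp
      (tupleBoundary (E := E) 0) = 0 from DFunLike.congr_fun h c
  refine free_hom_ext fun v => ?_
  simp [tupleBoundary_single, Fin.sum_univ_two, AddMonoidHom.comp_apply]

/-- Every tuple is the cone over its tail with its first entry as apex, so the cone formula lowers
the degree by one. -/
theorem tupleBoundary_tupleBoundary (l : ℕ) (c : TupleChain E (l + 2)) :
    tupleBoundary l (tupleBoundary (l + 1) c) = 0 := by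
  induction l with
  | zero =>
    suffices h : (tupleBoundary 0).comp (tupleBoundary (E := E) 1) = 0 from
      DFunLike.congr_fun h c
    refine free_hom_ext fun v => ?_
    have hv : Finsupp.single v (1 : ℤ) = tupleCone (v 0) 1 (Finsupp.single (Fin.tail v) 1) := by
      rw [tupleCone_single, Fin.cons_self_tail]
    rw [AddMonoidHom.comp_apply, hv, tupleBoundary_tupleCone, map_sub,
      tupleBoundary_tupleCone_zero, augmentation_tupleBoundary, sub_zero, sub_self,
      AddMonoidHom.zero_apply]
  | succ l ih =>
    suffices h : (tupleBoundary (l + 1)).comp (tupleBoundary (E := E) (l + 2)) = 0 from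
      DFunLike.congr_fun h c
    refine free_hom_ext fun v => ?_
    have hv : Finsupp.single v (1 : ℤ) =
        tupleCone (v 0) (l + 2) (Finsupp.single (Fin.tail v) 1) := by
      rw [tupleCone_single, Fin.cons_self_tail]
    rw [AddMonoidHom.comp_apply, hv, tupleBoundary_tupleCone, map_sub, tupleBoundary_tupleCone,
      ih, map_zero, sub_zero, sub_self, AddMonoidHom.zero_apply]

/-! ### Barycentric subdivision of formal chains -/

variable (β : ∀ l : ℕ, (Fin (l + 1) → E) → E)

/-- The barycentric subdivision of formal chains, for a choice `β` of barycenters. -/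
def tupleSd : ∀ l : ℕ, TupleChain E l →+ TupleChain E l
  | 0 => AddMonoidHom.id _
  | l + 1 => freeLift fun v =>
      tupleCone (β (l + 1) v) l (tupleSd l (tupleBoundary l (Finsupp.single v 1)))

/-- A chain homotopy between the identity and the barycentric subdivision. -/
def tupleHomotopy : ∀ l : ℕ, TupleChain E l →+ TupleChain E (l + 1)
  -- Subdivision is the identity in degree 0, so no homotopy is needed there.
  | 0 => 0
  | l + 1 => freeLift fun v => tupleCone (β (l + 1) v) (l + 1)
      (Finsupp.single v 1 - tupleHomotopy l (tupleBoundary l (Finsupp.single v 1)))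

theorem tupleSd_single (l : ℕ) (v : Fin (l + 2) → E) :
    tupleSd β (l + 1) (Finsupp.single v 1) =
      tupleCone (β (l + 1) v) l (tupleSd β l (tupleBoundary l (Finsupp.single v 1))) :=
  freeLift_single _ v

theorem tupleHomotopy_single (l : ℕ) (v : Fin (l + 2) → E) :
    tupleHomotopy β (l + 1) (Finsupp.single v 1) = tupleCone (β (l + 1) v) (l + 1)
      (Finsupp.single v 1 - tupleHomotopy β l (tupleBoundary l (Finsupp.single v 1))) :=
  freeLift_single _ v

theorem tupleBoundary_tupleSd (l : ℕ) (c : TupleChain E (l + 1)) :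
    tupleBoundary l (tupleSd β (l + 1) c) = tupleSd β l (tupleBoundary l c) := by
  induction l with
  | zero =>
    suffices h : (tupleBoundary 0).comp (tupleSd β 1) = (tupleSd β 0).comp (tupleBoundary 0) from
      DFunLike.congr_fun h c
    refine free_hom_ext fun v => ?_
    rw [AddMonoidHom.comp_apply, tupleSd_single, tupleBoundary_tupleCone_zero]
    change _ - freeLift _ (tupleBoundary 0 _) = _
    rw [augmentation_tupleBoundary, sub_zero]
    rfl
  | succ l ih =>
    suffices h : (tupleBoundary (l + 1)).comp (tupleSd β (l + 2)) =
        (tupleSd β (l + 1)).comp (tupleBoundary (l + 1)) from DFunLike.congr_fun h c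
    refine free_hom_ext fun v => ?_
    rw [AddMonoidHom.comp_apply, tupleSd_single, tupleBoundary_tupleCone, ih,
      tupleBoundary_tupleBoundary, map_zero, map_zero, sub_zero]
    rfl

theorem tupleBoundary_tupleHomotopy (l : ℕ) (c : TupleChain E (l + 1)) :
    tupleBoundary (l + 1) (tupleHomotopy β (l + 1) c) =
      c - tupleSd β (l + 1) c - tupleHomotopy β l (tupleBoundary l c) := by
  induction l with
  | zero =>
    suffices h : (tupleBoundary 1).comp (tupleHomotopy β 1) =
        AddMonoidHom.id _ - tupleSd β 1 - (tupleHomotopy β 0).comp (tupleBoundary 0) from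
      DFunLike.congr_fun h c
    refine free_hom_ext fun v => ?_
    simp only [AddMonoidHom.comp_apply, AddMonoidHom.sub_apply, AddMonoidHom.id_apply]
    rw [tupleHomotopy_single, tupleBoundary_tupleCone, tupleSd_single]
    simp [tupleHomotopy, tupleSd]
  | succ l ih =>
    suffices h : (tupleBoundary (l + 2)).comp (tupleHomotopy β (l + 2)) =
        AddMonoidHom.id _ - tupleSd β (l + 2) -
          (tupleHomotopy β (l + 1)).comp (tupleBoundary (l + 1)) from
      DFunLike.congr_fun h c
    refine free_hom_ext fun v => ?_
    simp only [AddMonoidHom.comp_apply, AddMonoidHom.sub_apply, AddMonoidHom.id_apply]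
    rw [tupleHomotopy_single, tupleBoundary_tupleCone, tupleSd_single, map_sub (tupleBoundary _),
      ih, tupleBoundary_tupleBoundary, map_zero, sub_zero, sub_sub_cancel]
    abel

end Tuples

section Naturality

variable {E E' : Type*}

/-- The map of formal chains induced by a map of vertices. -/
def tupleMap (g : E → E') (l : ℕ) : TupleChain E l →+ TupleChain E' l :=
  freeLift fun v => Finsupp.single (g ∘ v) (1 : ℤ)

theorem tupleMap_single (g : E → E') {l : ℕ} (v : Fin (l + 1) → E) :
    tupleMap g l (Finsupp.single v 1) = Finsupp.single (g ∘ v) 1 :=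
  freeLift_single _ v

theorem tupleMap_tupleBoundary (g : E → E') (l : ℕ) (c : TupleChain E (l + 1)) :
    tupleMap g l (tupleBoundary l c) = tupleBoundary l (tupleMap g (l + 1) c) := by
  suffices h : (tupleMap g l).comp (tupleBoundary l) =
      (tupleBoundary l).comp (tupleMap g (l + 1)) from DFunLike.congr_fun h c
  refine free_hom_ext fun v => ?_
  simp only [AddMonoidHom.comp_apply, tupleMap_single, tupleBoundary_single, map_sum, map_zsmul]
  rfl

theorem tupleMap_tupleCone (g : E → E') (b : E) (l : ℕ) (c : TupleChain E l) :
    tupleMap g (l + 1) (tupleCone b l c) = tupleCone (g b) l (tupleMap g l c) := by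
  suffices h : (tupleMap g (l + 1)).comp (tupleCone b l) =
      (tupleCone (g b) l).comp (tupleMap g l) from DFunLike.congr_fun h c
  refine free_hom_ext fun v => ?_
  simp only [AddMonoidHom.comp_apply, tupleMap_single, tupleCone_single]
  congr 1
  funext t
  refine Fin.cases ?_ (fun t => ?_) t <;> simp

variable {β : ∀ l : ℕ, (Fin (l + 1) → E) → E} {β' : ∀ l : ℕ, (Fin (l + 1) → E') → E'}
  {g : E → E'}

theorem tupleMap_tupleSd
    (hg : ∀ (l : ℕ) (v : Fin (l + 1) → E), g (β l v) = β' l (g ∘ v))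
    (l : ℕ) (c : TupleChain E l) :
    tupleMap g l (tupleSd β l c) = tupleSd β' l (tupleMap g l c) := by
  induction l with
  | zero => rfl
  | succ l ih =>
    suffices h : (tupleMap g (l + 1)).comp (tupleSd β (l + 1)) =
        (tupleSd β' (l + 1)).comp (tupleMap g (l + 1)) from DFunLike.congr_fun h c
    refine free_hom_ext fun v => ?_
    simp only [AddMonoidHom.comp_apply, tupleMap_single, tupleSd_single, tupleMap_tupleCone, ih,
      tupleMap_tupleBoundary, hg]

theorem tupleMap_tupleHomotopy
    (hg : ∀ (l : ℕ) (v : Fin (l + 1) → E), g (β l v) = β' l (g ∘ v))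
    (l : ℕ) (c : TupleChain E l) :
    tupleMap g (l + 1) (tupleHomotopy β l c) = tupleHomotopy β' l (tupleMap g l c) := by
  induction l with
  | zero => simp [tupleHomotopy]
  | succ l ih =>
    suffices h : (tupleMap g (l + 2)).comp (tupleHomotopy β (l + 1)) =
        (tupleHomotopy β' (l + 1)).comp (tupleMap g (l + 1)) from DFunLike.congr_fun h c
    refine free_hom_ext fun v => ?_
    simp only [AddMonoidHom.comp_apply, tupleMap_single, tupleHomotopy_single, tupleMap_tupleCone,
      map_sub, ih, tupleMap_tupleBoundary, hg]

end Naturality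

/-! ### Affine simplices in convex sets -/

section Affine

variable {V : Type*} [NormedAddCommGroup V] [NormedSpace ℝ V] {C : Set V} (hC : Convex ℝ C)

/-- The affine singular simplex with prescribed vertices in a convex set. -/
def affineSimplex {l : ℕ} (v : Fin (l + 1) → C) : Simplex C l where
  toFun t := ⟨∑ i, t i • (v i : V),
    hC.sum_mem (fun i _ => t.2.1 i) t.2.2 fun i _ => (v i).2⟩
  continuous_toFun := by
    refine Continuous.subtype_mk (continuous_finsetSum _ fun i _ => ?_) _
    exact ((continuous_apply i).comp continuous_subtype_val).smul continuous_const

theorem affineSimplex_coe {l : ℕ} (v : Fin (l + 1) → C) (t : stdSimplex ℝ (Fin (l + 1))) :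
    (affineSimplex hC v t : V) = ∑ i, t i • (v i : V) := rfl

theorem pull_affineSimplex {k l : ℕ} (f : Fin (l + 1) → Fin (k + 1)) (v : Fin (k + 1) → C) :
    Simplex.pull f (affineSimplex hC v) = affineSimplex hC (v ∘ f) := by
  classical
  ext t
  change (affineSimplex hC v (stdSimplex.map f t) : V) = _
  rw [affineSimplex_coe, affineSimplex_coe]
  simp only [stdSimplex.map_coe, FunOnFinite.linearMap_apply_apply, Finset.sum_smul,
    Function.comp_apply]
  rw [← Finset.sum_fiberwise Finset.univ f fun i => t i • (v (f i) : V)]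
  refine Finset.sum_congr rfl fun j _ => Finset.sum_congr rfl fun i hi => ?_
  rw [(Finset.mem_filter.mp hi).2]

/-- The vertices of the standard simplex. -/
def simplexVertices (k : ℕ) : Fin (k + 1) → stdSimplex ℝ (Fin (k + 1)) := fun i => stdSimplex.vertex i

theorem affineSimplex_vertex {l : ℕ} (v : Fin (l + 1) → C) (i : Fin (l + 1)) :
    affineSimplex hC v (simplexVertices l i) = v i := by
  refine Subtype.ext ?_
  rw [affineSimplex_coe, simplexVertices]
  simp [Pi.single_apply]

theorem affineSimplex_comp {k l : ℕ} (v : Fin (k + 1) → C)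
    (w : Fin (l + 1) → stdSimplex ℝ (Fin (k + 1))) :
    (affineSimplex hC v).comp (affineSimplex (convex_stdSimplex ℝ _) w) =
      affineSimplex hC (affineSimplex hC v ∘ w) := by
  ext t
  change (affineSimplex hC v (affineSimplex (convex_stdSimplex ℝ _) w t) : V) = _
  have h : ∀ j, (affineSimplex (convex_stdSimplex ℝ _) w t) j = ∑ i, t i * (w i) j := fun j => by
    change (affineSimplex (convex_stdSimplex ℝ _) w t).1 j = _
    rw [affineSimplex_coe, Finset.sum_apply]
    rfl
  simp only [affineSimplex_coe, Function.comp_apply, h, Finset.sum_smul, Finset.smul_sum,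
    smul_smul]
  exact Finset.sum_comm

theorem affineSimplex_simplexVertices (k : ℕ) :
    affineSimplex (convex_stdSimplex ℝ _) (simplexVertices k) = ContinuousMap.id _ := by
  ext t j
  change (affineSimplex (convex_stdSimplex ℝ _) (simplexVertices k) t).1 j = t j
  rw [affineSimplex_coe, Finset.sum_apply]
  simp [simplexVertices, Pi.single_apply]

theorem affineSimplex_mem {l : ℕ} (v : Fin (l + 1) → C) {K : Set V} (hK : Convex ℝ K)
    (h : ∀ i, (v i : V) ∈ K) (t : stdSimplex ℝ (Fin (l + 1))) : (affineSimplex hC v t : V) ∈ K :=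
  hK.sum_mem (fun i _ => t.2.1 i) t.2.2 fun i _ => h i

/-- The barycenter of an affine simplex. -/
def baryPoint (l : ℕ) (v : Fin (l + 1) → C) : C := affineSimplex hC v stdSimplex.barycenter

theorem affineSimplex_baryPoint {k : ℕ} (v : Fin (k + 1) → C) (l : ℕ)
    (w : Fin (l + 1) → stdSimplex ℝ (Fin (k + 1))) :
    affineSimplex hC v (baryPoint (convex_stdSimplex ℝ _) l w) =
      baryPoint hC l (affineSimplex hC v ∘ w) :=
  DFunLike.congr_fun (affineSimplex_comp hC v w) _

/-- The difference is the average of the `l + 1` vectors `v i - v j`, of which the one with `i = j`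
is zero. -/
theorem dist_baryPoint_le {l : ℕ} (v : Fin (l + 1) → C) {D : ℝ} (h : ∀ i j, dist (v i) (v j) ≤ D)
    (j : Fin (l + 1)) : dist (v j) (baryPoint hC l v) ≤ (l / (l + 1) : ℝ) * D := by
  rw [Subtype.dist_eq, dist_comm, dist_eq_norm, baryPoint, affineSimplex_coe]
  have hb : ∀ i, (stdSimplex.barycenter : stdSimplex ℝ (Fin (l + 1))) i = ((l : ℝ) + 1)⁻¹ := by
    intro i
    change ((Fintype.card (Fin (l + 1)) : ℝ))⁻¹ = _
    simp
  have hl : (l : ℝ) + 1 ≠ 0 := by positivity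
  have h1 : ∑ i, (stdSimplex.barycenter : stdSimplex ℝ (Fin (l + 1))) i • (v i : V) - v j =
      ∑ i, ((l : ℝ) + 1)⁻¹ • ((v i : V) - v j) := by
    simp only [hb, smul_sub, Finset.sum_sub_distrib, Finset.sum_const, Finset.card_univ,
      Fintype.card_fin]
    rw [← Nat.cast_smul_eq_nsmul ℝ, smul_smul]
    push_cast
    rw [mul_inv_cancel₀ hl, one_smul]
  rw [h1]
  have h2 : ∀ i, ‖((l : ℝ) + 1)⁻¹ • ((v i : V) - v j)‖ ≤
      if i = j then 0 else ((l : ℝ) + 1)⁻¹ * D := by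
    intro i
    split_ifs with hij
    · simp [hij]
    · rw [norm_smul, Real.norm_of_nonneg (by positivity), ← dist_eq_norm]
      exact mul_le_mul_of_nonneg_left (h i j) (by positivity)
  refine (norm_sum_le_of_le _ fun i _ => h2 i).trans (le_of_eq ?_)
  rw [Finset.sum_ite, Finset.sum_const_zero, zero_add, Finset.sum_const, Finset.filter_ne' _ j,
    Finset.card_erase_of_mem (Finset.mem_univ _)]
  simp
  field_simp

/-- The singular chain given by a formal chain with vertices in a convex set. -/
def realize (l : ℕ) : TupleChain C l →+ Chain C l :=
  freeLift fun v => Finsupp.single (affineSimplex hC v) (1 : ℤ)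

theorem realize_single {l : ℕ} (v : Fin (l + 1) → C) :
    realize hC l (Finsupp.single v 1) = Finsupp.single (affineSimplex hC v) 1 :=
  freeLift_single _ v

theorem boundary_realize (l : ℕ) (c : TupleChain C (l + 1)) :
    boundary C l (realize hC (l + 1) c) = realize hC l (tupleBoundary l c) := by
  suffices h : (boundary C l).comp (realize hC (l + 1)) = (realize hC l).comp (tupleBoundary l) from
    DFunLike.congr_fun h c
  refine free_hom_ext fun v => ?_
  simp only [AddMonoidHom.comp_apply, realize_single, boundary_single, tupleBoundary_single,
    map_sum, map_zsmul, Simplex.face, pull_affineSimplex]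

theorem chainMap_realize {k : ℕ} (v : Fin (k + 1) → C) (l : ℕ)
    (c : TupleChain (stdSimplex ℝ (Fin (k + 1))) l) :
    chainMap (affineSimplex hC v) l (realize (convex_stdSimplex ℝ _) l c) =
      realize hC l (tupleMap (affineSimplex hC v) l c) := by
  suffices h : (chainMap (affineSimplex hC v) l).comp (realize (convex_stdSimplex ℝ _) l) =
      (realize hC l).comp (tupleMap (affineSimplex hC v) l) from DFunLike.congr_fun h c
  refine free_hom_ext fun w => ?_
  simp only [AddMonoidHom.comp_apply, realize_single, chainMap_single, tupleMap_single,
    affineSimplex_comp]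

theorem tupleMap_simplexVertices {k : ℕ} (v : Fin (k + 1) → C) :
    tupleMap (affineSimplex hC v) k (Finsupp.single (simplexVertices k) 1) =
      Finsupp.single v 1 := by
  rw [tupleMap_single]
  congr 1
  funext i
  exact affineSimplex_vertex hC v i

end Affine

/-! ### Barycentric subdivision of singular chains -/

section Subdivision

variable {X Y : Type*} [TopologicalSpace X] [TopologicalSpace Y]

theorem chainMap_chainMap {W : Type*} [TopologicalSpace W] (f : C(Y, W)) (g : C(X, Y)) (k : ℕ)
    (c : Chain X k) : chainMap f k (chainMap g k c) = chainMap (f.comp g) k c := by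
  suffices h : (chainMap f k).comp (chainMap g k) = chainMap (f.comp g) k from
    DFunLike.congr_fun h c
  refine chain_hom_ext fun σ => ?_
  simp only [AddMonoidHom.comp_apply, chainMap_single]
  rfl

theorem chainMap_mem_subChain (f : C(X, Y)) {A : Set Y} (h : Set.range f ⊆ A) {k : ℕ}
    (c : Chain X k) : chainMap f k c ∈ subChain A k := by
  refine freeLift_mem fun σ _ => ?_
  rw [chainMap_single]
  refine single_mem_subChain ?_ 1
  rintro _ ⟨t, rfl⟩
  exact h ⟨_, rfl⟩

/-- The barycentric subdivision of singular chains. -/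
def sd (k : ℕ) : Chain X k →+ Chain X k :=
  chainLift fun σ : Simplex X k => chainMap σ k (realize (convex_stdSimplex ℝ _) k
    (tupleSd (baryPoint (convex_stdSimplex ℝ _)) k (Finsupp.single (simplexVertices k) 1)))

/-- A natural chain homotopy between the identity and the barycentric subdivision. -/
def sdHomotopy (k : ℕ) : Chain X k →+ Chain X (k + 1) :=
  chainLift fun σ : Simplex X k => chainMap σ (k + 1) (realize (convex_stdSimplex ℝ _) (k + 1)
    (tupleHomotopy (baryPoint (convex_stdSimplex ℝ _)) k (Finsupp.single (simplexVertices k) 1)))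

theorem sd_chainMap (f : C(X, Y)) (k : ℕ) (c : Chain X k) :
    sd k (chainMap f k c) = chainMap f k (sd k c) := by
  suffices h : (sd k).comp (chainMap f k) = (chainMap f k).comp (sd k) from DFunLike.congr_fun h c
  refine chain_hom_ext fun σ => ?_
  simp only [AddMonoidHom.comp_apply, chainMap_single, sd, chainLift_single, chainMap_chainMap]

theorem sdHomotopy_chainMap (f : C(X, Y)) (k : ℕ) (c : Chain X k) :
    sdHomotopy k (chainMap f k c) = chainMap f (k + 1) (sdHomotopy k c) := by
  suffices h : (sdHomotopy k).comp (chainMap f k) = (chainMap f (k + 1)).comp (sdHomotopy k) from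
    DFunLike.congr_fun h c
  refine chain_hom_ext fun σ => ?_
  simp only [AddMonoidHom.comp_apply, chainMap_single, sdHomotopy, chainLift_single,
    chainMap_chainMap]

section

variable {V : Type*} [NormedAddCommGroup V] [NormedSpace ℝ V] {C : Set V} (hC : Convex ℝ C)

/-- Affine maps preserve barycenters, so singular and formal subdivision agree on affine simplices.
-/
theorem sd_realize (k : ℕ) (c : TupleChain C k) :
    sd k (realize hC k c) = realize hC k (tupleSd (baryPoint hC) k c) := by
  suffices h : (sd k).comp (realize hC k) = (realize hC k).comp (tupleSd (baryPoint hC) k) from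
    DFunLike.congr_fun h c
  refine free_hom_ext fun v => ?_
  simp only [AddMonoidHom.comp_apply, realize_single, sd, chainLift_single]
  rw [chainMap_realize, tupleMap_tupleSd (affineSimplex_baryPoint hC v), tupleMap_simplexVertices]

theorem sdHomotopy_realize (k : ℕ) (c : TupleChain C k) :
    sdHomotopy k (realize hC k c) = realize hC (k + 1) (tupleHomotopy (baryPoint hC) k c) := by
  suffices h : (sdHomotopy k).comp (realize hC k) =
      (realize hC (k + 1)).comp (tupleHomotopy (baryPoint hC) k) from DFunLike.congr_fun h c
  refine free_hom_ext fun v => ?_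
  simp only [AddMonoidHom.comp_apply, realize_single, sdHomotopy, chainLift_single]
  rw [chainMap_realize, tupleMap_tupleHomotopy (affineSimplex_baryPoint hC v),
    tupleMap_simplexVertices]

end

/-- Every singular simplex is the image of the universal affine one. By naturality, this reduces
identities for `sd` and `sdHomotopy` to formal chains. -/
theorem single_eq_chainMap {k : ℕ} (σ : Simplex X k) :
    Finsupp.single σ (1 : ℤ) = chainMap σ k (realize (convex_stdSimplex ℝ _) k
      (Finsupp.single (simplexVertices k) 1)) := by
  rw [realize_single, affineSimplex_simplexVertices, chainMap_single]
  rfl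

theorem boundary_sd (k : ℕ) (c : Chain X (k + 1)) :
    boundary X k (sd (k + 1) c) = sd k (boundary X k c) := by
  suffices h : (boundary X k).comp (sd (k + 1)) = (sd k).comp (boundary X k) from
    DFunLike.congr_fun h c
  refine chain_hom_ext fun σ => ?_
  simp only [AddMonoidHom.comp_apply, single_eq_chainMap, sd_chainMap, chainMap_boundary,
    sd_realize, boundary_realize, tupleBoundary_tupleSd]

theorem boundary_sdHomotopy (k : ℕ) (c : Chain X (k + 1)) :
    boundary X (k + 1) (sdHomotopy (k + 1) c) =
      c - sd (k + 1) c - sdHomotopy k (boundary X k c) := by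
  suffices h : (boundary X (k + 1)).comp (sdHomotopy (k + 1)) =
      AddMonoidHom.id _ - sd (k + 1) - (sdHomotopy k).comp (boundary X k) from
    DFunLike.congr_fun h c
  refine chain_hom_ext fun σ => ?_
  simp only [AddMonoidHom.comp_apply, AddMonoidHom.sub_apply, AddMonoidHom.id_apply,
    single_eq_chainMap, sd_chainMap, sdHomotopy_chainMap, chainMap_boundary,
    sd_realize, sdHomotopy_realize, boundary_realize, tupleBoundary_tupleHomotopy, map_sub]

theorem sd_mem_subChain {A : Set X} {k : ℕ} {c : Chain X k} (hc : c ∈ subChain A k) :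
    sd k c ∈ subChain A k :=
  freeLift_mem fun σ hσ => by
    rw [sd, chainLift_single]
    exact chainMap_mem_subChain σ (hc σ hσ) _

theorem sdHomotopy_mem_subChain {A : Set X} {k : ℕ} {c : Chain X k} (hc : c ∈ subChain A k) :
    sdHomotopy k c ∈ subChain A (k + 1) :=
  freeLift_mem fun σ hσ => by
    rw [sdHomotopy, chainLift_single]
    exact chainMap_mem_subChain σ (hc σ hσ) _

theorem boundary_sd_iterate (k r : ℕ) (c : Chain X (k + 1)) :
    boundary X k ((sd (k + 1))^[r] c) = (sd k)^[r] (boundary X k c) := by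
  induction r generalizing c with
  | zero => rfl
  | succ r ih => rw [Function.iterate_succ_apply, ih, boundary_sd, Function.iterate_succ_apply]

/-- If the boundary of a chain lies in a subdivision-invariant group `S`, and a cocycle vanishes on
`sdHomotopy k c` for all `c ∈ S`, then the cocycle takes the same value on all subdivisions of the
chain. -/
theorem map_sd_iterate {M : Type*} [AddCommGroup M] {k : ℕ} (φ : Chain X (k + 1) →+ M)
    (hφ : ∀ c, φ (boundary X (k + 1) c) = 0) (S : AddSubgroup (Chain X k))
    (hS : ∀ c ∈ S, sd k c ∈ S) (hS' : ∀ c ∈ S, φ (sdHomotopy k c) = 0) (r : ℕ)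
    (c : Chain X (k + 1)) (hc : boundary X k c ∈ S) : φ ((sd (k + 1))^[r] c) = φ c := by
  induction r generalizing c with
  | zero => rfl
  | succ r ih =>
    rw [Function.iterate_succ_apply, ih _ (by rw [boundary_sd]; exact hS _ hc)]
    -- Apply `φ` to `∂T c = c - sd c - T ∂c`; the left side and the last term die.
    have h := hφ (sdHomotopy (k + 1) c)
    rw [boundary_sdHomotopy, map_sub, map_sub, hS' _ hc, sub_zero, sub_eq_zero] at h
    exact h.symm

end Subdivision

/-! ### Subdivisions are fine -/

section Mesh

/-- The formal chains all of whose simplices satisfy a given condition. -/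
def tupleSupp {E : Type*} {l : ℕ} (P : (Fin (l + 1) → E) → Prop) : AddSubgroup (TupleChain E l) where
  carrier := {c | ∀ v, c v ≠ 0 → P v}
  zero_mem' := fun v h => absurd rfl h
  add_mem' {a b} ha hb v h := by
    by_cases h' : a v = 0
    · exact hb v (by simpa [h'] using h)
    · exact ha v h'
  neg_mem' {a} ha v h := ha v (by simpa using h)

theorem single_mem_tupleSupp {E : Type*} {l : ℕ} {P : (Fin (l + 1) → E) → Prop}
    {v : Fin (l + 1) → E} (h : P v) (a : ℤ) : Finsupp.single v a ∈ tupleSupp P := by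
  intro w hw
  obtain rfl : v = w := by
    by_contra hne
    exact hw (Finsupp.single_eq_of_ne (Ne.symm hne))
  exact h

theorem tupleBoundary_mem_tupleSupp {E : Type*} {l : ℕ} {P : (Fin (l + 1) → E) → Prop}
    {v : Fin (l + 2) → E} (h : ∀ i : Fin (l + 2), P (v ∘ i.succAbove)) :
    tupleBoundary l (Finsupp.single v 1) ∈ tupleSupp P := by
  rw [tupleBoundary_single]
  exact AddSubgroup.sum_mem _ fun i _ => AddSubgroup.zsmul_mem _ (single_mem_tupleSupp (h i) 1) _

variable {V : Type*} [NormedAddCommGroup V] [NormedSpace ℝ V] {C : Set V} (hC : Convex ℝ C)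

/-- Used with `K` a ball around the barycenter of a simplex, to bound the distance from this
barycenter to the vertices of the subdivided faces. -/
theorem tupleSd_mem_convex {K : Set V} (hK : Convex ℝ K) {l : ℕ} {c : TupleChain C l}
    (hc : c ∈ tupleSupp fun v : Fin (l + 1) → C => ∀ i, (v i : V) ∈ K) :
    tupleSd (baryPoint hC) l c ∈ tupleSupp fun v : Fin (l + 1) → C => ∀ i, (v i : V) ∈ K := by
  induction l with
  | zero => exact hc
  | succ l ih =>
    refine freeLift_mem fun v hv => ?_
    have hv' := hc v hv
    rw [tupleSd_single]
    have h := ih (tupleBoundary_mem_tupleSupp (v := v)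
      (P := fun v : Fin (l + 1) → C => ∀ i, (v i : V) ∈ K) fun i j => hv' _)
    refine freeLift_mem fun w hw => ?_
    rw [tupleCone_single]
    refine single_mem_tupleSupp (fun i => ?_) 1
    refine Fin.cases ?_ (fun i => ?_) i
    · exact affineSimplex_mem hC v hK hv' _
    · exact h w hw i

/-- A simplex of the subdivision is the cone from the barycenter over a simplex of a subdivided
face. Distances within the face are bounded by induction, as `l / (l + 1)` increases with `l`;
distances to the apex by `dist_baryPoint_le` and convexity of balls. -/
theorem tupleSd_mem_diam {l : ℕ} {D : ℝ} {c : TupleChain C l}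
    (hc : c ∈ tupleSupp fun v => ∀ i j, dist (v i) (v j) ≤ D) :
    tupleSd (baryPoint hC) l c ∈
      tupleSupp fun v => ∀ i j, dist (v i) (v j) ≤ (l / (l + 1) : ℝ) * D := by
  induction l with
  | zero =>
    intro v hv i j
    rw [show i = j from Subsingleton.elim (α := Fin 1) i j]
    simp
  | succ l ih =>
    refine freeLift_mem fun v hv => ?_
    have hv' := hc v hv
    have hD : 0 ≤ D := dist_nonneg.trans (hv' 0 0)
    rw [tupleSd_single]
    set b := baryPoint hC (l + 1) v with hb
    have h := ih (tupleBoundary_mem_tupleSupp (P := fun v => ∀ i j, dist (v i) (v j) ≤ D) (v := v)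
      fun i j k => hv' _ _)
    have h2 := tupleSd_mem_convex hC (convex_closedBall (b : V)
        (((l + 1 : ℕ) / ((l + 1 : ℕ) + 1) : ℝ) * D))
      (tupleBoundary_mem_tupleSupp (P := fun v : Fin (l + 1) → C => ∀ i, (v i : V) ∈ _) (v := v)
      fun i j => Metric.mem_closedBall.mpr (dist_baryPoint_le hC v hv' _))
    refine freeLift_mem fun w hw => ?_
    rw [tupleCone_single]
    have hw1 : ∀ i j, dist (w i) (w j) ≤ ((l + 1 : ℕ) / ((l + 1 : ℕ) + 1) : ℝ) * D := fun i j => by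
      refine (h w hw i j).trans (mul_le_mul_of_nonneg_right ?_ hD)
      push_cast
      rw [div_le_div_iff₀ (by positivity) (by positivity)]
      nlinarith
    have hw2 : ∀ i, dist (w i) b ≤ ((l + 1 : ℕ) / ((l + 1 : ℕ) + 1) : ℝ) * D := fun i => h2 w hw i
    refine single_mem_tupleSupp (fun i j => ?_) 1
    refine Fin.cases ?_ (fun i => ?_) i <;> refine Fin.cases ?_ (fun j => ?_) j
    · simp only [dist_self]
      positivity
    · simp only [Fin.cons_zero, Fin.cons_succ]
      rw [dist_comm]
      exact hw2 j
    · exact hw2 i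
    · exact hw1 i j

theorem tupleSd_iterate_mem_diam {l : ℕ} {D : ℝ} {c : TupleChain C l}
    (hc : c ∈ tupleSupp fun v => ∀ i j, dist (v i) (v j) ≤ D) (r : ℕ) :
    (tupleSd (baryPoint hC) l)^[r] c ∈
      tupleSupp fun v => ∀ i j, dist (v i) (v j) ≤ (l / (l + 1) : ℝ) ^ r * D := by
  induction r with
  | zero => simpa using hc
  | succ r ih =>
    rw [Function.iterate_succ_apply']
    have h := tupleSd_mem_diam hC ih
    rw [← mul_assoc, ← pow_succ'] at h
    exact h

variable {X : Type*} [TopologicalSpace X]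

theorem sd_iterate_single {k : ℕ} (σ : Simplex X k) (r : ℕ) :
    (sd k)^[r] (Finsupp.single σ 1) = chainMap σ k (realize (convex_stdSimplex ℝ _) k
      ((tupleSd (baryPoint (convex_stdSimplex ℝ _)) k)^[r]
        (Finsupp.single (simplexVertices k) 1))) := by
  induction r with
  | zero => exact single_eq_chainMap σ
  | succ r ih => rw [Function.iterate_succ_apply', ih, sd_chainMap, sd_realize,
      Function.iterate_succ_apply']

/-- Once the mesh is below a Lebesgue number of the cover `σ ⁻¹' U i`, each small simplex lies in
one `U i`. The conclusion holds for all large `r`, so that one `r` serves all simplices of a chain.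
-/
theorem exists_sd_iterate_single_eq_zero {M ι : Type*} [AddCommGroup M] {k : ℕ}
    (φ : Chain X k →+ M) (U : ι → Set X) (hU : ∀ i, IsOpen (U i))
    (hφ : ∀ (i : ι) (σ : Simplex X k), Set.range σ ⊆ U i → φ (Finsupp.single σ 1) = 0)
    (σ : Simplex X k) (hσ : Set.range σ ⊆ ⋃ i, U i) :
    ∃ r₀, ∀ r, r₀ ≤ r → φ ((sd k)^[r] (Finsupp.single σ 1)) = 0 := by
  obtain ⟨δ, hδ, hL⟩ := lebesgue_number_lemma_of_metric (s := Set.univ)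
    (c := fun i => σ ⁻¹' U i) isCompact_univ (fun i => (hU i).preimage σ.continuous) (by
      intro t _
      simpa using hσ ⟨t, rfl⟩)
  obtain ⟨r₀, hr₀⟩ := exists_pow_lt_of_lt_one hδ
    (show (k / (k + 1) : ℝ) < 1 by rw [div_lt_one (by positivity)]; linarith)
  refine ⟨r₀, fun r hr => ?_⟩
  rw [sd_iterate_single]
  have hv : Finsupp.single (simplexVertices k) (1 : ℤ) ∈
      tupleSupp fun v : Fin (k + 1) → stdSimplex ℝ (Fin (k + 1)) =>
        ∀ i j, dist (v i) (v j) ≤ 1 := by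
    refine single_mem_tupleSupp (fun i j => ?_) 1
    rw [Subtype.dist_eq]
    exact (Metric.dist_le_diam_of_mem (bounded_stdSimplex _) (Subtype.prop _)
      (Subtype.prop _)).trans diam_stdSimplex_le
  have hd := tupleSd_iterate_mem_diam (convex_stdSimplex ℝ _) hv r
  have hmem : ((φ.comp (chainMap σ k)).comp (realize (convex_stdSimplex ℝ _) k))
      ((tupleSd (baryPoint (convex_stdSimplex ℝ _)) k)^[r]
        (Finsupp.single (simplexVertices k) 1)) ∈ (⊥ : AddSubgroup M) := by
    refine freeLift_mem fun v hv => AddSubgroup.mem_bot.mpr ?_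
    have hv' := hd v hv
    obtain ⟨i, hi⟩ := hL (v 0) (Set.mem_univ _)
    simp only [AddMonoidHom.comp_apply, realize_single, chainMap_single]
    refine hφ i _ ?_
    rintro _ ⟨t, rfl⟩
    refine hi (Metric.mem_ball.mpr (lt_of_le_of_lt ?_ hr₀))
    rw [Subtype.dist_eq]
    refine Metric.mem_closedBall.mp (affineSimplex_mem (convex_stdSimplex ℝ _) v
      (convex_closedBall _ _) (fun j => Metric.mem_closedBall.mpr ?_) t)
    refine (hv' j 0).trans ?_
    rw [mul_one]
    exact pow_le_pow_of_le_one (by positivity) (by rw [div_le_one (by positivity)]; linarith) hr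
  exact AddSubgroup.mem_bot.mp hmem

theorem exists_sd_iterate_eq_zero {M ι : Type*} [AddCommGroup M] {k : ℕ}
    (φ : Chain X k →+ M) (U : ι → Set X) (hU : ∀ i, IsOpen (U i))
    (hφ : ∀ (i : ι) (σ : Simplex X k), Set.range σ ⊆ U i → φ (Finsupp.single σ 1) = 0)
    (c : Chain X k) (hc : c ∈ subChain (⋃ i, U i) k) :
    ∃ r, φ ((sd k)^[r] c) = 0 := by
  choose! r₀ hr₀ using exists_sd_iterate_single_eq_zero φ U hU hφ
  refine ⟨c.support.sup r₀, ?_⟩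
  set r := c.support.sup r₀
  have h : (φ.comp (AddMonoidHom.mk' (sd k)^[r] (iterate_map_add (sd k) r))) c ∈
      (⊥ : AddSubgroup M) := by
    refine freeLift_mem fun σ hσ => AddSubgroup.mem_bot.mpr ?_
    exact hr₀ σ (hc σ hσ) r (Finset.le_sup (Finsupp.mem_support_iff.mpr hσ))
  exact AddSubgroup.mem_bot.mp h

end Mesh

/-! ### The cocycle on the circle that counts crossings of the origin -/

theorem exists_circle_lift {k : ℕ} (σ : Simplex UnitAddCircle k) :
    ∃ F : C(stdSimplex ℝ (Fin (k + 1)), ℝ), ∀ t, (F t : UnitAddCircle) = σ t := by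
  have : ContractibleSpace (stdSimplex ℝ (Fin (k + 1))) :=
    (convex_stdSimplex ℝ (Fin (k + 1))).contractibleSpace
      ⟨_, single_mem_stdSimplex ℝ (0 : Fin (k + 1))⟩
  have : LocallyPathConnectedSpace (stdSimplex ℝ (Fin (k + 1))) :=
    (convex_stdSimplex ℝ (Fin (k + 1))).locallyPathConnectedSpace
  obtain ⟨x, hx⟩ := QuotientAddGroup.mk_surjective (σ (simplexVertices k 0))
  obtain ⟨F, ⟨-, hF⟩, -⟩ := (AddCircle.isCoveringMap_coe (1 : ℝ)).existsUnique_continuousMap_lifts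
    σ (simplexVertices k 0) x hx
  exact ⟨F, fun t => congrFun hF t⟩

/-- The number of times that a path in the circle crosses the origin, counted with signs. -/
def crossing : Cochain UnitAddCircle 1 := fun e =>
  ⌊(exists_circle_lift e).choose (simplexVertices 1 1)⌋ -
    ⌊(exists_circle_lift e).choose (simplexVertices 1 0)⌋

/-- Two lifts of a path differ by a constant integer, which cancels in the difference of floors. -/
theorem crossing_eq (e : Simplex UnitAddCircle 1) (G : C(stdSimplex ℝ (Fin 2), ℝ))
    (hG : ∀ t, (G t : UnitAddCircle) = e t) :
    crossing e = ⌊G (simplexVertices 1 1)⌋ - ⌊G (simplexVertices 1 0)⌋ := by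
  obtain ⟨F, hF, hc⟩ : ∃ F : C(stdSimplex ℝ (Fin 2), ℝ), (∀ t, (F t : UnitAddCircle) = e t) ∧
      crossing e = ⌊F (simplexVertices 1 1)⌋ - ⌊F (simplexVertices 1 0)⌋ :=
    ⟨_, (exists_circle_lift e).choose_spec, rfl⟩
  obtain ⟨n, hn⟩ : ∃ n : ℤ, F (simplexVertices 1 0) = G (simplexVertices 1 0) + n := by
    have h := (hF (simplexVertices 1 0)).trans (hG _).symm
    obtain ⟨n, hn⟩ := AddSubgroup.mem_zmultiples_iff.mp (QuotientAddGroup.eq.mp h)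
    refine ⟨-n, ?_⟩
    simp at hn
    push_cast
    linarith
  have h : (F : stdSimplex ℝ (Fin 2) → ℝ) = fun t => G t + n := by
    refine (AddCircle.isCoveringMap_coe (1 : ℝ)).eq_of_comp_eq F.continuous (by fun_prop) ?_
      (simplexVertices 1 0) hn
    funext t
    have h1 : ((n : ℝ) : UnitAddCircle) = 0 := by
      rw [AddCircle.coe_eq_zero_iff]
      exact ⟨n, by simp⟩
    rw [Function.comp_apply, Function.comp_apply, AddCircle.coe_add, h1, add_zero, hF, hG]
  rw [hc, h]
  simp

/-- One lift of the 2-simplex restricts to lifts of its three edges, and the floors at the vertices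
cancel. -/
theorem crossing_mem_cocycle : crossing ∈ Cocycle1 UnitAddCircle := by
  change coboundary UnitAddCircle 1 crossing = 0
  funext σ
  obtain ⟨F, hF⟩ := exists_circle_lift σ
  have h : ∀ i : Fin 3, crossing (Simplex.face i σ) =
      ⌊F (simplexVertices 2 (i.succAbove 1))⌋ - ⌊F (simplexVertices 2 (i.succAbove 0))⌋ := by
    intro i
    rw [crossing_eq (Simplex.face i σ) (F.comp ⟨stdSimplex.map i.succAbove,
      stdSimplex.continuous_map _⟩) fun t => hF _]
    simp only [ContinuousMap.comp_apply, ContinuousMap.coe_mk, simplexVertices,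
      stdSimplex.map_vertex]
  change ∑ i : Fin 3, (-1 : ℤ) ^ (i : ℕ) * crossing (Simplex.face i σ) = 0
  simp only [h, Fin.sum_univ_three]
  have e00 : (0 : Fin 3).succAbove (0 : Fin 2) = 1 := rfl
  have e01 : (0 : Fin 3).succAbove (1 : Fin 2) = 2 := rfl
  have e10 : (1 : Fin 3).succAbove (0 : Fin 2) = 0 := rfl
  have e11 : (1 : Fin 3).succAbove (1 : Fin 2) = 2 := rfl
  have e20 : (2 : Fin 3).succAbove (0 : Fin 2) = 0 := rfl
  have e21 : (2 : Fin 3).succAbove (1 : Fin 2) = 1 := rfl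
  rw [e00, e01, e10, e11, e20, e21]
  simp

/-- A lift takes no integer value, so by the intermediate value theorem its floor is constant. -/
theorem crossing_eq_zero (e : Simplex UnitAddCircle 1) (he : ∀ t, e t ≠ 0) : crossing e = 0 := by
  obtain ⟨F, hF⟩ := exists_circle_lift e
  have hint : ∀ t (n : ℤ), F t ≠ n := by
    intro t n h
    refine he t ?_
    rw [← hF, h, AddCircle.coe_eq_zero_iff]
    exact ⟨n, by simp⟩
  have hle : ∀ s t, ⌊F s⌋ ≤ ⌊F t⌋ := by
    intro s t
    by_contra! hlt
    have h1 : F t ≤ (⌊F s⌋ : ℝ) := (Int.floor_lt.mp hlt).le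
    obtain ⟨r, hr⟩ := mem_range_of_exists_le_of_exists_ge F.continuous ⟨t, h1⟩
      ⟨s, Int.floor_le _⟩
    exact hint r _ hr
  rw [crossing_eq e F hF, sub_eq_zero]
  exact le_antisymm (hle _ _) (hle _ _)

section Pull

variable {X Y : Type*} [TopologicalSpace X] [TopologicalSpace Y]

/-- The pull-back of a singular cochain. -/
def pullCochain (f : C(X, Y)) {k : ℕ} (b : Cochain Y k) : Cochain X k := fun σ => b (f.comp σ)

theorem pullCochain_mem_cocycle (f : C(X, Y)) {b : Cochain Y 1} (hb : b ∈ Cocycle1 Y) :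
    pullCochain f b ∈ Cocycle1 X :=
  funext fun σ => congrFun (show coboundary Y 1 b = 0 from hb) (f.comp σ)

end Pull

/-- The difference of the `i`-th coordinates of a variable point and a fixed point of the torus. -/
def torusCoord {n : ℕ} (t : UnitAddTorus (Fin n)) (i : Fin n) :
    C(UnitAddTorus (Fin n), UnitAddCircle) :=
  ⟨fun y => y i - t i, (continuous_apply i).sub continuous_const⟩

/-- The cocycle that counts the crossings of the wall `{y | y i = t i}` of the torus. -/
def wallCochain {n : ℕ} (t : UnitAddTorus (Fin n)) (i : Fin n) :
    Cochain (UnitAddTorus (Fin n)) 1 :=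
  pullCochain (torusCoord t i) crossing

theorem wallCochain_mem_cocycle {n : ℕ} (t : UnitAddTorus (Fin n)) (i : Fin n) :
    wallCochain t i ∈ Cocycle1 (UnitAddTorus (Fin n)) :=
  pullCochain_mem_cocycle _ crossing_mem_cocycle

theorem wallCochain_eq_zero {n : ℕ} (t : UnitAddTorus (Fin n)) (i : Fin n)
    (e : Simplex (UnitAddTorus (Fin n)) 1) (he : Set.range e ⊆ {y | y i ≠ t i}) :
    wallCochain t i e = 0 :=
  crossing_eq_zero _ fun s => sub_ne_zero.mpr (he ⟨s, rfl⟩)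

/-! ### Evaluation of cup products of `1`-cochains -/

section EvalCup

variable {X Y : Type*} [TopologicalSpace X] [TopologicalSpace Y]

/-- The evaluation of the cup product of `n` cochains of degree `1` on chains of degree `n`. -/
def evalCup : ∀ n : ℕ, (Fin n → Cochain X 1) → Chain X n →+ ℤ
  | 0, _ => chainLift fun _ => 1
  | n + 1, b => (evalCup n (Fin.tail b)).comp (capChain n (b 0))

theorem evalCup_succ (n : ℕ) (b : Fin (n + 1) → Cochain X 1) (c : Chain X (n + 1)) :
    evalCup (n + 1) b c = evalCup n (Fin.tail b) (capChain n (b 0) c) := rfl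

theorem evalCup_boundary (n : ℕ) (b : Fin n → Cochain X 1) (hb : ∀ i, b i ∈ Cocycle1 X)
    (c : Chain X (n + 1)) : evalCup n b (boundary X n c) = 0 := by
  induction n with
  | zero =>
    suffices h : (evalCup 0 b).comp (boundary X 0) = 0 from DFunLike.congr_fun h c
    refine chain_hom_ext fun σ => ?_
    rw [AddMonoidHom.comp_apply, boundary_single, Fin.sum_univ_two]
    simp [evalCup, chainLift_single]
  | succ n ih =>
    rw [evalCup_succ, ← neg_neg (capChain n (b 0) _), ← boundary_capChain n (b 0) (hb 0), map_neg,
      ih (Fin.tail b) fun i => hb i.succ, neg_zero]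

theorem evalCup_single (n : ℕ) (b : Fin n → Cochain X 1) (σ : Simplex X n) :
    evalCup n b (Finsupp.single σ 1) =
      ∏ i : Fin n, b i (Simplex.pull ![i.castSucc, i.succ] σ) := by
  induction n with
  | zero => simp [evalCup, chainLift_single]
  | succ n ih =>
    rw [evalCup_succ, capChain_single, map_zsmul, ih, Fin.prod_univ_succ, smul_eq_mul]
    congr 1
    · congr 1
      rw [Simplex.edge]
      congr 1
      funext j
      fin_cases j <;> rfl
    · refine Finset.prod_congr rfl fun i _ => ?_
      rw [Simplex.face, Simplex.pull_pull]
      have h : (0 : Fin (n + 2)).succAbove ∘ ![i.castSucc, i.succ] =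
          ![i.succ.castSucc, i.succ.succ] := by
        funext j
        fin_cases j <;> simp
      rw [h]
      rfl

/-- One vanishing factor is enough. Hence a product of wall cocycles is a relative cocycle as soon
as `A` misses one of the walls. -/
theorem evalCup_eq_zero {n : ℕ} (b : Fin n → Cochain X 1) {A : Set X} (i : Fin n)
    (hi : ∀ e : Simplex X 1, Set.range e ⊆ A → b i e = 0) {c : Chain X n}
    (hc : c ∈ subChain A n) : evalCup n b c = 0 := by
  have h : subChain A n ≤ (⊥ : AddSubgroup ℤ).comap (evalCup n b) := by
    refine subChain_le_comap A _ _ fun σ hσ => AddSubgroup.mem_bot.mpr ?_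
    rw [evalCup_single]
    exact Finset.prod_eq_zero (Finset.mem_univ i) (hi _ ((Simplex.range_pull _ σ).trans hσ))
  exact AddSubgroup.mem_bot.mp (h hc)

theorem evalCup_pullCochain (f : C(X, Y)) (n : ℕ) (b : Fin n → Cochain Y 1) (c : Chain X n) :
    evalCup n (fun i => pullCochain f (b i)) c = evalCup n b (chainMap f n c) := by
  suffices h : evalCup n (fun i => pullCochain f (b i)) = (evalCup n b).comp (chainMap f n) from
    DFunLike.congr_fun h c
  refine chain_hom_ext fun σ => ?_
  rw [AddMonoidHom.comp_apply, chainMap_single, evalCup_single, evalCup_single]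
  rfl

/-- The three faces of a constant 2-simplex coincide, and their alternating sum is a single term. -/
theorem cocycle_const {b : Cochain X 1} (hb : b ∈ Cocycle1 X) (x : X) :
    b (ContinuousMap.const _ x) = 0 := by
  have h := congrFun (show coboundary X 1 b = 0 from hb) (ContinuousMap.const _ x)
  have h' : ∀ i : Fin 3, Simplex.face i (ContinuousMap.const (stdSimplex ℝ (Fin 3)) x) =
      ContinuousMap.const _ x := fun i => rfl
  change ∑ i : Fin 3, (-1 : ℤ) ^ (i : ℕ) *
    b (Simplex.face i (ContinuousMap.const (stdSimplex ℝ (Fin 3)) x)) = 0 at h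
  simpa [h', Fin.sum_univ_three] using h

end EvalCup

/-! ### Evaluation on relative and locally finite homology -/

section RelEval

variable {X : Type*} [TopologicalSpace X]

theorem mk_eq_zero_iff {A : Set X} {k : ℕ} (c : Chain X k) :
    RelChain.mk A k c = 0 ↔ c ∈ subChain A k :=
  QuotientAddGroup.eq_zero_iff c

theorem mk_mem_cycles_iff {A : Set X} {k : ℕ} (c : Chain X (k + 1)) :
    RelChain.mk A (k + 1) c ∈ cycles (relBoundary A) (k + 1) ↔ boundary X k c ∈ subChain A k :=
  mk_eq_zero_iff (boundary X k c)

theorem Represents.sub {A : Set X} {k : ℕ} {c c' : Chain X k} {τ τ' : RelHomology A k}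
    (h : Represents c τ) (h' : Represents c' τ') : Represents (c - c') (τ - τ') := by
  obtain ⟨h, rfl⟩ := h
  obtain ⟨h', rfl⟩ := h'
  refine ⟨by rw [map_sub]; exact AddSubgroup.sub_mem _ h h', ?_⟩
  rw [← map_sub]
  rfl

theorem Represents.zsmul {A : Set X} {k : ℕ} {c : Chain X k} {τ : RelHomology A k}
    (h : Represents c τ) (a : ℤ) : Represents (a • c) (a • τ) := by
  obtain ⟨h, rfl⟩ := h
  refine ⟨by rw [map_zsmul]; exact AddSubgroup.zsmul_mem _ h a, ?_⟩
  rw [← map_zsmul]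
  rfl

theorem Represents.exists_eq_of_zero {A : Set X} {k : ℕ} {c : Chain X k}
    (h : Represents c (0 : RelHomology A k)) :
    ∃ e ∈ subChain A k, ∃ b, c = e + boundary X k b := by
  obtain ⟨hc, h0⟩ := h
  obtain ⟨b, hb⟩ := (Homology.mk_eq_zero_iff _ _ _).mp h0.symm
  obtain ⟨b, rfl⟩ := RelChain.mk_surjective _ _ b
  refine ⟨c - boundary X k b, ?_, b, (sub_add_cancel _ _).symm⟩
  rw [← mk_eq_zero_iff, map_sub, sub_eq_zero]
  exact hb.symm

/-- A relative cocycle takes the same value on all representatives of a class. -/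
theorem Represents.map_eq {A : Set X} {k : ℕ} {c c' : Chain X k} {τ : RelHomology A k}
    (h : Represents c τ) (h' : Represents c' τ) (φ : Chain X k →+ ℤ)
    (h0 : ∀ c ∈ subChain A k, φ c = 0) (h1 : ∀ c, φ (boundary X k c) = 0) : φ c = φ c' := by
  have hs := h.sub h'
  rw [sub_self] at hs
  obtain ⟨e, he, b, hb⟩ := hs.exists_eq_of_zero
  rw [← sub_eq_zero, ← map_sub, hb, map_add, h0 e he, h1, add_zero]

/-- The singular chain `a` represents the restriction of the class `τ` of locally finite homology
to a compact set `K`, on the chain level. -/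
def LFRepresents {k : ℕ} (K : Compacts X) (a : Chain X k) (τ : LFHomology X k) : Prop :=
  ∃ z : cycles (C := fun k => LFChain X k) (lfBoundary X) k,
    τ = Homology.mk (C := fun k => LFChain X k) (lfBoundary X) k z ∧
      RelChain.mk ((K : Set X)ᶜ) k a = z.1.1 K

theorem exists_lfRepresents {k : ℕ} (K : Compacts X) (τ : LFHomology X k) :
    ∃ a, LFRepresents K a τ := by
  obtain ⟨z, rfl⟩ := Homology.mk_surjective _ _ τ
  obtain ⟨a, ha⟩ := RelChain.mk_surjective _ _ (z.1.1 K)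
  exact ⟨a, z, rfl, ha⟩

/-- One chain chosen for a large compact set represents all smaller restrictions at once, for
instance those to the wall neighbourhood and to a single point of it. -/
theorem LFRepresents.represents_restrict {k : ℕ} {K L : Compacts X} {a : Chain X k}
    {τ : LFHomology X k} (h : LFRepresents L a τ) {W : Set X} (hKL : (K : Set X) ⊆ L)
    (hW : W ⊆ K) : Represents a (LFHomology.restrict K W hW k τ) := by
  obtain ⟨z, rfl, ha⟩ := h
  have hz := z.1.2 K L hKL
  rw [← ha] at hz
  have key : relFactor (Set.compl_subset_compl.mpr hW) k (z.1.1 K) = RelChain.mk Wᶜ k a := by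
    rw [← hz]
    rfl
  have hmem : relFactor (Set.compl_subset_compl.mpr hW) k (z.1.1 K) ∈
      cycles (relBoundary Wᶜ) k := by
    cases k with
    | zero => exact AddSubgroup.mem_top _
    | succ k =>
      change relBoundary Wᶜ k _ = 0
      rw [relFactor_boundary]
      have h0 : lfBoundary X k z.1 = 0 := z.2
      have h1 : relBoundary _ k (z.1.1 K) = 0 := congrFun (congrArg Subtype.val h0) K
      rw [h1, map_zero]
  refine ⟨key ▸ hmem, ?_⟩
  exact congrArg (Homology.mk (relBoundary Wᶜ) k) (Subtype.ext key)

theorem LFRepresents.cap {k : ℕ} {K : Compacts X} {a : Chain X (k + 1)}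
    {τ : LFHomology X (k + 1)} (h : LFRepresents K a τ) (b : Cocycle1 X) :
    LFRepresents K (capChain k b.1 a) (SYS.cap k (QuotientAddGroup.mk b) τ) := by
  obtain ⟨z, rfl, ha⟩ := h
  refine ⟨_, rfl, ?_⟩
  change _ = relCap _ k b.1 (z.1.1 K)
  rw [← ha]
  rfl

theorem LFRepresents.map {Y : Type*} [TopologicalSpace Y] (f : C(X, Y)) (hf : IsProperMap f)
    {k : ℕ} {K : Compacts Y} {a : Chain X k} {τ : LFHomology X k}
    (h : LFRepresents (preimageCompacts f hf K) a τ) :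
    LFRepresents K (chainMap f k a) (LFHomology.map f hf k τ) := by
  obtain ⟨z, rfl, ha⟩ := h
  refine ⟨_, rfl, ?_⟩
  change _ = relMap f _ k (z.1.1 (preimageCompacts f hf K))
  rw [← ha]
  rfl

/-- `evalCup` caps with its cochains from the front, exactly as `iterCap` does. Stopping after `m`
of them leaves a 2-chain on which the last two are still to be evaluated. -/
theorem LFRepresents.iterCap {m : ℕ} {K : Compacts X} {a : Chain X (m + 2)}
    {τ : LFHomology X (m + 2)} (h : LFRepresents K a τ) (b : Fin (m + 2) → Cocycle1 X) :
    ∃ a' : Chain X 2,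
      LFRepresents K a' (SYS.iterCap m τ fun i => QuotientAddGroup.mk (b (Fin.castAdd 2 i))) ∧
      evalCup 2 (fun i => (b (Fin.natAdd m i)).1) a' = evalCup (m + 2) (fun i => (b i).1) a := by
  induction m with
  | zero =>
    refine ⟨a, h, ?_⟩
    congr 2
    funext i
    congr 2
    simp
  | succ m ih =>
    obtain ⟨a', h1, h2⟩ := ih (h.cap (b 0)) (Fin.tail b)
    refine ⟨a', h1, ?_⟩
    have hb : (fun i : Fin 2 => (b (Fin.natAdd (m + 1) i)).1) =
        fun i => (Fin.tail b (Fin.natAdd m i)).1 := by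
      funext i
      rw [Fin.tail]
      congr 2
      ext
      simp
      omega
    rw [hb, h2]
    rfl

end RelEval

/-! ### The fundamental chain of the cube -/

/-- The cube `[-1, 1]ⁿ`. -/
abbrev cube (n : ℕ) : Set (Fin n → ℝ) := Set.Icc (-1) 1

theorem convex_cube (n : ℕ) : Convex ℝ (cube n) := convex_Icc _ _

/-- The vertices of the simplex of the cube that belongs to a permutation: they are obtained from
`(-1, …, -1)` by changing the signs of the coordinates one after the other. -/
def cubeVertex {n : ℕ} (π : Equiv.Perm (Fin n)) (j : Fin (n + 1)) : cube n :=
  ⟨fun i => if (π.symm i : ℕ) < j then 1 else -1, by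
    constructor <;> intro i <;> dsimp <;> split_ifs <;> norm_num⟩

theorem cubeVertex_apply {n : ℕ} (π : Equiv.Perm (Fin n)) (j : Fin (n + 1)) (i : Fin n) :
    (cubeVertex π j : Fin n → ℝ) i = if (π.symm i : ℕ) < j then 1 else -1 := rfl

/-- The fundamental chain of the cube. -/
def cubeChain (n : ℕ) : TupleChain (cube n) n :=
  ∑ π : Equiv.Perm (Fin n), (Equiv.Perm.sign π : ℤ) • Finsupp.single (cubeVertex π) 1

/-- Without vertex `j` it is invisible in which order steps `j - 1` and `j` change their
coordinates. Exchanging them pairs off the inner faces with opposite signs. -/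
theorem sum_cubeVertex_face {k : ℕ} (j : Fin (k + 2)) (h0 : j ≠ 0) (hk : j ≠ Fin.last (k + 1)) :
    ∑ π : Equiv.Perm (Fin (k + 1)), (Equiv.Perm.sign π : ℤ) •
      Finsupp.single (cubeVertex π ∘ j.succAbove) (1 : ℤ) = 0 := by
  have h0' : (j : ℕ) ≠ 0 := fun h => h0 (Fin.ext h)
  have hk' : (j : ℕ) ≠ k + 1 := fun h => hk (Fin.ext h)
  have hj := j.isLt
  let a : Fin (k + 1) := ⟨j - 1, by omega⟩
  let b : Fin (k + 1) := ⟨j, by omega⟩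
  have hab : a ≠ b := fun h => by
    have := congrArg Fin.val h
    simp only [a, b] at this
    omega
  refine Finset.sum_involution (fun π _ => π * Equiv.swap a b) (fun π _ => ?_) (fun π _ _ h => ?_)
    (fun _ _ => Finset.mem_univ _) (fun π _ => ?_)
  · have h : cubeVertex (π * Equiv.swap a b) ∘ j.succAbove = cubeVertex π ∘ j.succAbove := by
      funext l
      refine Subtype.ext (funext fun i => ?_)
      simp only [Function.comp_apply, cubeVertex_apply]
      have hs : (π * Equiv.swap a b).symm i = Equiv.swap a b (π.symm i) := rfl
      have hl : (j.succAbove l : ℕ) ≠ j := fun h => Fin.succAbove_ne j l (Fin.ext h)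
      have hiff : ((Equiv.swap a b (π.symm i) : Fin (k + 1)) : ℕ) < j.succAbove l ↔
          (π.symm i : ℕ) < j.succAbove l := by
        rw [Equiv.swap_apply_def]
        split_ifs with h1 h2
        · rw [h1]
          simp only [a, b]
          omega
        · rw [h2]
          simp only [a, b]
          omega
        · rfl
      rw [hs]
      simp only [hiff]
    rw [h, Equiv.Perm.sign_mul, Equiv.Perm.sign_swap hab, ← add_smul]
    simp
  · exact hab (Equiv.swap_eq_one_iff.mp (mul_eq_left.mp h))
  · rw [mul_assoc, Equiv.swap_mul_self, mul_one]

/-- Only the faces opposite to the first and last vertices survive. On them the coordinate changed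
first is constantly 1, respectively the one changed last is constantly -1. -/
theorem tupleBoundary_cubeChain (k : ℕ) :
    tupleBoundary k (cubeChain (k + 1)) ∈ tupleSupp fun v : Fin (k + 1) → cube (k + 1) =>
      ∃ i, (∀ l, (v l : Fin (k + 1) → ℝ) i = 1) ∨ ∀ l, (v l : Fin (k + 1) → ℝ) i = -1 := by
  rw [cubeChain, map_sum]
  simp only [map_zsmul, tupleBoundary_single, Finset.smul_sum]
  rw [Finset.sum_comm]
  refine AddSubgroup.sum_mem _ fun j _ => ?_
  simp only [smul_comm _ ((-1 : ℤ) ^ (j : ℕ))]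
  rw [← Finset.smul_sum]
  refine AddSubgroup.zsmul_mem _ ?_ _
  by_cases h0 : j = 0
  · subst h0
    refine AddSubgroup.sum_mem _ fun π _ => AddSubgroup.zsmul_mem _ (single_mem_tupleSupp
      ⟨π 0, Or.inl fun l => ?_⟩ _) _
    simp [cubeVertex_apply]
  by_cases hk : j = Fin.last (k + 1)
  · subst hk
    refine AddSubgroup.sum_mem _ fun π _ => AddSubgroup.zsmul_mem _ (single_mem_tupleSupp
      ⟨π (Fin.last k), Or.inr fun l => ?_⟩ _) _
    have hl := l.isLt
    simp only [Function.comp_apply, cubeVertex_apply, Equiv.symm_apply_apply, Fin.succAbove_last,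
      Fin.val_last, Fin.val_castSucc]
    rw [if_neg (by omega)]
  rw [sum_cubeVertex_face j h0 hk]
  exact zero_mem _

/-! ### Wall cocycles on a small cube -/

/-- A map from the cube to a subset of the torus that is a homothety in coordinates. -/
structure CubeChart {n : ℕ} (Y : Set (UnitAddTorus (Fin n))) (t : UnitAddTorus (Fin n)) where
  toMap : C(cube n, Y)
  scale : ℝ
  scale_pos : 0 < scale
  scale_lt_one : scale < 1
  apply_eq : ∀ x i, (toMap x : UnitAddTorus (Fin n)) i = t i + ((scale * x.1 i : ℝ) : UnitAddCircle)

section Chart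

variable {n : ℕ} {Y : Set (UnitAddTorus (Fin n))} {t : UnitAddTorus (Fin n)}

/-- The inclusion of a subset of the torus. -/
def torusIncl (Y : Set (UnitAddTorus (Fin n))) : C(Y, UnitAddTorus (Fin n)) :=
  ⟨Subtype.val, continuous_subtype_val⟩

/-- The cube chain in a subset of the torus. -/
def CubeChart.chain (κ : CubeChart Y t) : Chain Y n :=
  chainMap κ.toMap n (realize (convex_cube n) n (cubeChain n))

/-- The `i`-th edge moves only coordinate `π i`, from -1 to 1. It crosses the `i`-th wall exactly
when `π i = i`. -/
theorem CubeChart.wallCochain_pull (κ : CubeChart Y t) (π : Equiv.Perm (Fin n)) (i : Fin n) :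
    pullCochain (torusIncl Y) (wallCochain t i) (Simplex.pull ![i.castSucc, i.succ]
      (κ.toMap.comp (affineSimplex (convex_cube n) (cubeVertex π)))) =
      if π i = i then 1 else 0 := by
  have h1 : Simplex.pull ![i.castSucc, i.succ]
      (κ.toMap.comp (affineSimplex (convex_cube n) (cubeVertex π))) =
      κ.toMap.comp (affineSimplex (convex_cube n) (cubeVertex π ∘ ![i.castSucc, i.succ])) := by
    rw [← pull_affineSimplex]
    rfl
  rw [h1]
  set A := affineSimplex (convex_cube n) (cubeVertex π ∘ ![i.castSucc, i.succ]) with hA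
  have h2 := crossing_eq ((torusCoord t i).comp ((torusIncl Y).comp (κ.toMap.comp A)))
    ⟨fun s => κ.scale * (A s).1 i, continuous_const.mul
      ((continuous_apply i).comp (continuous_subtype_val.comp A.continuous))⟩ fun s => by
        change _ = (κ.toMap (A s) : UnitAddTorus (Fin n)) i - t i
        rw [κ.apply_eq, add_sub_cancel_left]
        rfl
  refine h2.trans ?_
  simp only [ContinuousMap.coe_mk, hA, affineSimplex_vertex, Function.comp_apply,
    Matrix.cons_val_zero, Matrix.cons_val_one, cubeVertex_apply, Fin.val_castSucc, Fin.val_succ]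
  -- As `0 < scale < 1`, the lift `scale * x i` has floor 0 at one end and -1 at the other, which
  -- makes one positive crossing.
  have f1 : ⌊κ.scale * 1⌋ = 0 := by
    rw [mul_one, Int.floor_eq_zero_iff]
    exact ⟨κ.scale_pos.le, κ.scale_lt_one⟩
  have f2 : ⌊κ.scale * -1⌋ = -1 := by
    rw [Int.floor_eq_iff]
    push_cast
    constructor <;> linarith [κ.scale_pos, κ.scale_lt_one]
  have h3 : π i = i ↔ (π.symm i : ℕ) = i := by
    rw [← Fin.ext_iff, Equiv.symm_apply_eq, eq_comm]
  by_cases c1 : (π.symm i : ℕ) < i + 1 <;> by_cases c2 : (π.symm i : ℕ) < i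
  · rw [if_pos c1, if_pos c2, sub_self, if_neg (by rw [h3]; omega)]
  · rw [if_pos c1, if_neg c2, f1, f2, if_pos (by rw [h3]; omega)]
    norm_num
  · omega
  · rw [if_neg c1, if_neg c2, sub_self, if_neg (by rw [h3]; omega)]

/-- The product over all edges is zero unless `π` fixes every index, so only the identity
contributes. -/
theorem CubeChart.evalCup_chain (κ : CubeChart Y t) :
    evalCup n (fun i => pullCochain (torusIncl Y) (wallCochain t i)) κ.chain = 1 := by
  rw [CubeChart.chain, cubeChain]
  simp only [map_sum, map_zsmul, realize_single, chainMap_single, evalCup_single,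
    κ.wallCochain_pull]
  rw [Finset.sum_eq_single 1]
  · simp
  · intro π _ hπ
    obtain ⟨i, hi⟩ : ∃ i, π i ≠ i := by
      by_contra! h
      exact hπ (Equiv.ext h)
    rw [Finset.prod_eq_zero (Finset.mem_univ i) (if_neg hi), smul_zero]
  · exact fun h => absurd (Finset.mem_univ _) h

end Chart

/-- On a face of the cube some coordinate is `t i ± scale`, which is not `t i` since `scale` lies
strictly between 0 and 1. -/
theorem CubeChart.boundary_chain {k : ℕ} {Y : Set (UnitAddTorus (Fin (k + 1)))}
    {t : UnitAddTorus (Fin (k + 1))} (κ : CubeChart Y t) :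
    boundary Y k κ.chain ∈ ⨆ i, subChain {y : Y | y.1 i ≠ t i} k := by
  rw [CubeChart.chain, chainMap_boundary, boundary_realize]
  have h := tupleBoundary_cubeChain k
  set c := tupleBoundary k (cubeChain (k + 1))
  change ((chainMap κ.toMap k).comp (realize (convex_cube (k + 1)) k)) c ∈ _
  refine freeLift_mem fun v hv => ?_
  obtain ⟨i, hi⟩ := h v hv
  rw [AddMonoidHom.comp_apply, realize_single, chainMap_single]
  refine AddSubgroup.mem_iSup_of_mem i (single_mem_subChain ?_ 1)
  have hne : ∀ s, (affineSimplex (convex_cube (k + 1)) v s).1 i = 1 ∨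
      (affineSimplex (convex_cube (k + 1)) v s).1 i = -1 := by
    intro s
    have hs : ∑ l, s l = 1 := s.2.2
    rw [affineSimplex_coe, Finset.sum_apply]
    simp only [Pi.smul_apply, smul_eq_mul]
    rcases hi with hi | hi
    · left
      simp [hi, hs]
    · right
      simp [hi, hs]
  rintro _ ⟨s, rfl⟩ heq
  change (κ.toMap (affineSimplex (convex_cube (k + 1)) v s)).1 i = t i at heq
  rw [κ.apply_eq, add_eq_left, AddCircle.coe_eq_zero_iff] at heq
  obtain ⟨z, hz⟩ := heq
  have hpos := κ.scale_pos
  have hlt := κ.scale_lt_one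
  simp at hz
  rcases hne s with h1 | h1 <;> rw [h1] at hz
  · have a1 : (0 : ℝ) < z := by linarith
    have a2 : (z : ℝ) < 1 := by linarith
    norm_cast at a1 a2
    omega
  · have a1 : (-1 : ℝ) < z := by linarith
    have a2 : (z : ℝ) < 0 := by linarith
    norm_cast at a1 a2
    omega

/-! ### Sets of dimension less than one in the torus -/

/-- Half of the circle is an isometric copy of `[0, 1/2]`. -/
theorem one_le_dimH_circle : 1 ≤ dimH (Set.univ : Set UnitAddCircle) := by
  let g : Set.Icc (0 : ℝ) (1 / 2) → UnitAddCircle := fun x => ((x : ℝ) : UnitAddCircle)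
  have hg : Isometry g := by
    refine Isometry.of_dist_eq fun x y => ?_
    rw [dist_eq_norm, Subtype.dist_eq, Real.dist_eq]
    change ‖(((x : ℝ) - y : ℝ) : UnitAddCircle)‖ = _
    rw [AddCircle.norm_coe_eq_abs_iff 1 one_ne_zero]
    rw [abs_le, abs_one]
    constructor <;> linarith [x.2.1, x.2.2, y.2.1, y.2.2]
  have h1 : dimH (Set.univ : Set (Set.Icc (0 : ℝ) (1 / 2))) = 1 := by
    rw [← (isometry_subtype_coe (s := Set.Icc (0 : ℝ) (1 / 2))).dimH_image, Set.image_univ,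
      Subtype.range_coe, Real.dimH_of_nonempty_interior, Module.finrank_self, Nat.cast_one]
    rw [interior_Icc, Set.nonempty_Ioo]
    norm_num
  rw [← h1, ← hg.dimH_image]
  exact dimH_mono (Set.subset_univ _)

/-- A compact set of dimension less than one in the torus has positive distance to a wall in every
coordinate direction. -/
theorem exists_walls {n : ℕ} {Γ : Set (UnitAddTorus (Fin n))} (hΓ : IsCompact Γ)
    (hdim : dimH Γ < 1) :
    ∃ (t : UnitAddTorus (Fin n)) (ε : ℝ), 0 < ε ∧ ∀ y ∈ Γ, ∀ i, ε < dist (y i) (t i) := by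
  have h : ∀ i : Fin n, ∃ (s : UnitAddCircle) (δ : ℝ), 0 < δ ∧ ∀ y ∈ Γ, δ ≤ dist (y i) s := by
    intro i
    have hd : dimH ((fun y : UnitAddTorus (Fin n) => y i) '' Γ) < 1 :=
      ((LipschitzWith.eval i).dimH_image_le Γ).trans_lt hdim
    obtain ⟨s, hs⟩ : ∃ s, s ∉ (fun y : UnitAddTorus (Fin n) => y i) '' Γ := by
      by_contra! hall
      rw [Set.eq_univ_of_forall hall] at hd
      exact absurd one_le_dimH_circle (not_le.mpr hd)
    obtain ⟨δ, hδ, hball⟩ := Metric.isOpen_iff.mp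
      (hΓ.image (continuous_apply i)).isClosed.isOpen_compl s hs
    refine ⟨s, δ, hδ, fun y hy => ?_⟩
    by_contra! hlt
    exact hball (Metric.mem_ball.mpr hlt) ⟨y, hy, rfl⟩
  choose t δ hδ ht using h
  have hev : ∀ᶠ ε in nhdsWithin (0 : ℝ) (Set.Ioi 0), ∀ i, ε < δ i :=
    Filter.eventually_all.mpr fun i => Filter.Eventually.filter_mono nhdsWithin_le_nhds
      (eventually_lt_nhds (hδ i))
  obtain ⟨ε, hε, hpos⟩ := (hev.and self_mem_nhdsWithin).exists
  exact ⟨t, ε, hpos, fun y hy i => (hε i).trans_le (ht i y hy)⟩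

section Walls

variable {n : ℕ} {Γ : Set (UnitAddTorus (Fin n))} {t : UnitAddTorus (Fin n)} {ε : ℝ}

/-- A small cube around the intersection point of the walls. -/
def wallChart (hε : 0 < ε) (hΓε : ∀ y ∈ Γ, ∀ i, ε < dist (y i) (t i)) (i₀ : Fin n) :
    CubeChart Γᶜ t where
  toMap := ⟨fun x => ⟨fun i => t i + ((min ε (1 / 2) * x.1 i : ℝ) : UnitAddCircle), fun hmem => by
    -- One coordinate within `ε` of the wall already keeps the point off `Γ`; this is why an index
    -- `i₀` is needed.
    have h := hΓε _ hmem i₀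
    rw [dist_eq_norm, add_sub_cancel_left] at h
    have h1 : ‖((min ε (1 / 2) * x.1 i₀ : ℝ) : UnitAddCircle)‖ ≤ |min ε (1 / 2) * x.1 i₀| :=
      QuotientAddGroup.norm_mk_le_norm
    have h2 : |x.1 i₀| ≤ 1 := abs_le.mpr ⟨x.2.1 i₀, x.2.2 i₀⟩
    have h3 : 0 < min ε (1 / 2) := lt_min hε (by norm_num)
    rw [abs_mul, abs_of_pos h3] at h1
    nlinarith [min_le_left ε (1 / 2)]⟩, by
      refine Continuous.subtype_mk (continuous_pi fun i => continuous_const.add ?_) _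
      exact (AddCircle.continuous_mk' 1).comp (continuous_const.mul
        ((continuous_apply i).comp continuous_subtype_val))⟩
  scale := min ε (1 / 2)
  scale_pos := lt_min hε (by norm_num)
  scale_lt_one := (min_le_right _ _).trans_lt (by norm_num)
  apply_eq _ _ := rfl

/-- The points of the complement of `Γ` that are close to one of the walls. -/
def wallNhd (hΓε : ∀ y ∈ Γ, ∀ i, ε < dist (y i) (t i)) :
    Compacts (Γᶜ : Set (UnitAddTorus (Fin n))) where
  carrier := {y | ∃ i, dist (y.1 i) (t i) ≤ ε}
  isCompact' := by
    -- The strict bound in `hΓε` makes the closed `ε`-neighbourhood of the walls disjoint from `Γ`,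
    -- so it is compact inside `Γᶜ`.
    rw [Subtype.isCompact_iff]
    have h : Subtype.val '' {y : (Γᶜ : Set (UnitAddTorus (Fin n))) | ∃ i, dist (y.1 i) (t i) ≤ ε} =
        ⋃ i, {y : UnitAddTorus (Fin n) | dist (y i) (t i) ≤ ε} := by
      ext y
      simp only [Set.mem_image, Set.mem_iUnion, Set.mem_ofPred_eq]
      constructor
      · rintro ⟨y, ⟨i, hi⟩, rfl⟩
        exact ⟨i, hi⟩
      · rintro ⟨i, hi⟩
        exact ⟨⟨y, fun hy => absurd (hΓε y hy i) (not_lt.mpr hi)⟩, ⟨i, hi⟩, rfl⟩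
    rw [h]
    refine (isClosed_iUnion_of_finite fun i => ?_).isCompact
    exact isClosed_le ((continuous_apply i).dist continuous_const) continuous_const

end Walls

/-! ### Non-vanishing on fundamental classes, vanishing on Hurewicz images -/

theorem LFRepresents.boundary_mem {X : Type*} [TopologicalSpace X] {k : ℕ} {K : Compacts X}
    {a : Chain X (k + 1)} {τ : LFHomology X (k + 1)} (h : LFRepresents K a τ) :
    boundary X k a ∈ subChain ((K : Set X)ᶜ) k :=
  (mk_mem_cycles_iff a).mp (h.represents_restrict subset_rfl subset_rfl).1

/-- The cup product of the wall cocycles does not vanish on the fundamental class of the complement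
of a set that misses the walls. -/
theorem evalCup_wallCochain_ne_zero {k : ℕ} {Γ : Set (UnitAddTorus (Fin (k + 1)))}
    {t : UnitAddTorus (Fin (k + 1))} {ε : ℝ} (hε : 0 < ε)
    (hΓε : ∀ y ∈ Γ, ∀ i, ε < dist (y i) (t i))
    (o : HomologyOrientation (Γᶜ : Set (UnitAddTorus (Fin (k + 1)))) (k + 1))
    {μ : LFHomology (Γᶜ : Set (UnitAddTorus (Fin (k + 1)))) (k + 1)} (hμ : IsFundamentalClass o μ)
    {a : Chain (Γᶜ : Set (UnitAddTorus (Fin (k + 1)))) (k + 1)}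
    (ha : LFRepresents (wallNhd hΓε) a μ) :
    evalCup (k + 1) (fun i => pullCochain (torusIncl Γᶜ) (wallCochain t i)) a ≠ 0 := by
  set b : Fin (k + 1) → Cochain (Γᶜ : Set (UnitAddTorus (Fin (k + 1)))) 1 :=
    fun i => pullCochain (torusIncl Γᶜ) (wallCochain t i) with hb
  let U : Fin (k + 1) → Set (Γᶜ : Set (UnitAddTorus (Fin (k + 1)))) := fun i => {y | y.1 i ≠ t i}
  have hU : ∀ i, IsOpen (U i) := fun i => isOpen_ne_fun
    ((continuous_apply i).comp continuous_subtype_val) continuous_const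
  have hbU : ∀ i (e : Simplex _ 1), Set.range e ⊆ U i → b i e = 0 := by
    intro i e he
    refine wallCochain_eq_zero t i _ ?_
    rintro _ ⟨s, rfl⟩
    exact he ⟨s, rfl⟩
  have hbc : ∀ c, evalCup (k + 1) b (boundary _ (k + 1) c) = 0 := evalCup_boundary _ b fun i =>
    pullCochain_mem_cocycle _ (wallCochain_mem_cocycle t i)
  have hev : ∀ i, subChain (U i) (k + 1) ≤ (evalCup (k + 1) b).ker := fun i c hc =>
    evalCup_eq_zero b i (hbU i) hc
  -- Subdivision does not change the value on a chain whose boundary is a sum of chains each missing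
  -- a wall: the homotopy preserves every `C_*(U i)`, where the product vanishes.
  have hinv : ∀ (r : ℕ) (c : Chain _ (k + 1)), boundary _ k c ∈ ⨆ i, subChain (U i) k →
      evalCup (k + 1) b ((sd (k + 1))^[r] c) = evalCup (k + 1) b c := by
    refine map_sd_iterate _ hbc _ (fun c hc => ?_) (fun c hc => ?_)
    · have h : ⨆ i, subChain (U i) k ≤ (⨆ i, subChain (U i) k).comap (sd k) :=
        iSup_le fun i c hc => AddSubgroup.mem_iSup_of_mem i (sd_mem_subChain hc)
      exact h hc
    · have h : ⨆ i, subChain (U i) k ≤ ((evalCup (k + 1) b).comp (sdHomotopy k)).ker :=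
        iSup_le fun i c hc => hev i (sdHomotopy_mem_subChain hc)
      exact h hc
  let p : (Γᶜ : Set (UnitAddTorus (Fin (k + 1)))) := ⟨t, fun h => by
    have := hΓε t h 0
    rw [dist_self] at this
    exact absurd this (not_lt.mpr hε.le)⟩
  -- The walls meet only in `p`, so the complements of the walls cover the complement of `p`.
  have hUp : ⋃ i, U i = {p}ᶜ := by
    ext y
    simp only [U, Set.mem_iUnion, Set.mem_ofPred_eq, Set.mem_compl_iff, Set.mem_singleton_iff]
    rw [Subtype.ext_iff, ← not_forall, not_iff_not]
    exact funext_iff.symm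
  have hpa : Represents a (o.gen p) := by
    rw [← hμ p]
    refine ha.represents_restrict ?_ subset_rfl
    rintro _ rfl
    exact ⟨0, by rw [dist_self]; exact hε.le⟩
  set c₀ := (wallChart hε hΓε 0).chain with hc₀
  have hc₀b : boundary _ k c₀ ∈ ⨆ i, subChain (U i) k := (wallChart hε hΓε 0).boundary_chain
  have hle : ⨆ i, subChain (U i) k ≤ subChain ({p}ᶜ) k :=
    iSup_le fun i => subChain_mono (hUp ▸ Set.subset_iUnion U i) k
  have hpc : Represents c₀ (Homology.mk (relBoundary ({p}ᶜ : Set _)) (k + 1)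
      ⟨RelChain.mk _ _ c₀, (mk_mem_cycles_iff c₀).mpr (hle hc₀b)⟩) := ⟨_, rfl⟩
  -- The orientation generates the local homology at `p`, so the cube is `q` times it for some
  -- integer `q`. It need not be known that the cube is a generator.
  obtain ⟨q, hq⟩ := AddSubgroup.mem_zmultiples_iff.mp
    (o.zmultiples_gen p ▸ AddSubgroup.mem_top (Homology.mk (relBoundary ({p}ᶜ : Set _)) (k + 1)
      ⟨RelChain.mk _ _ c₀, (mk_mem_cycles_iff c₀).mpr (hle hc₀b)⟩))
  have hz := hpc.sub (hpa.zsmul q)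
  rw [hq, sub_self] at hz
  obtain ⟨e, he, x, hx⟩ := hz.exists_eq_of_zero
  rw [← hUp] at he
  -- A simplex of `e` avoids `p` but may meet every wall; the product is zero only after
  -- subdivision.
  obtain ⟨r, hr⟩ := exists_sd_iterate_eq_zero (evalCup (k + 1) b) U hU
    (fun i σ hσ => hev i (single_mem_subChain hσ 1)) e he
  have hab : boundary _ k a ∈ ⨆ i, subChain (U i) k := by
    have hsub : ((wallNhd hΓε : Set (Γᶜ : Set (UnitAddTorus (Fin (k + 1)))))ᶜ) ⊆ U 0 :=
      fun y hy h => hy ⟨0, by rw [h, dist_self]; exact hε.le⟩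
    exact AddSubgroup.mem_iSup_of_mem 0 (subChain_mono hsub k ha.boundary_mem)
  have h1 : evalCup (k + 1) b c₀ = 1 := (wallChart hε hΓε 0).evalCup_chain
  -- Evaluating the subdivided identity `c₀ - q a = e + ∂x` gives `1 - q * evalCup a = 0`.
  have h2 := congrArg (fun c => evalCup (k + 1) b ((sd (k + 1))^[r] c)) hx
  simp only [iterate_map_sub, iterate_map_add, iterate_map_zsmul, map_sub, map_add, map_zsmul] at h2
  rw [hinv r _ hc₀b, hinv r _ hab, hr, ← boundary_sd_iterate, hbc, h1] at h2
  intro h0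
  rw [h0] at h2
  simp at h2

/-- Cup products of two cocycles, the first of which vanishes on `A`, vanish on the Hurewicz image
of the pair `(X, A)`. -/
theorem evalCup_eq_zero_of_mem_hurewiczImage {X : Type*} [TopologicalSpace X] {A : Set X}
    (b : Fin 2 → Cochain X 1) (hb : ∀ i, b i ∈ Cocycle1 X)
    (hA : ∀ e : Simplex X 1, Set.range e ⊆ A → b 0 e = 0) {τ : RelHomology A 2}
    (hτ : τ ∈ hurewiczImage A) {a : Chain X 2} (ha : Represents a τ) : evalCup 2 b a = 0 := by
  -- The edge `[v_0, v_1]` lies in `∂Δ²`, because its last barycentric coordinate is zero.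
  have hedge : ∀ s : stdSimplex ℝ (Fin 2),
      stdSimplex.map ![(0 : Fin 2).castSucc, (0 : Fin 2).succ] s ∈ diskBoundary := by
    intro s
    refine ⟨2, ?_⟩
    rw [stdSimplex.map_coe, FunOnFinite.linearMap_apply_apply]
    refine Finset.sum_eq_zero fun i hi => ?_
    exfalso
    revert hi
    fin_cases i <;> simp [Fin.ext_iff]
  have h0 : ∀ c ∈ subChain A 2, evalCup 2 b c = 0 := fun c hc => evalCup_eq_zero b 0 hA hc
  have h1 : ∀ c, evalCup 2 b (boundary X 2 c) = 0 := evalCup_boundary 2 b hb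
  have hconst : ∀ (σ : Simplex X 2) (x : X), (∀ s ∈ diskBoundary, σ s = x) →
      evalCup 2 b (Finsupp.single σ 1) = 0 := by
    intro σ x hσ
    rw [evalCup_single]
    refine Finset.prod_eq_zero (Finset.mem_univ 0) ?_
    have h : Simplex.pull ![(0 : Fin 2).castSucc, (0 : Fin 2).succ] σ = ContinuousMap.const _ x :=
      ContinuousMap.ext fun s => hσ _ (hedge s)
    rw [h, cocycle_const (hb 0)]
  rcases hτ with ⟨σ, hσ, hr⟩ | ⟨σ, x, hσ, hr⟩
  · rw [ha.map_eq hr _ h0 h1, evalCup_single]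
    refine Finset.prod_eq_zero (Finset.mem_univ 0) (hA _ ?_)
    rintro _ ⟨s, rfl⟩
    exact hσ (hedge s)
  · rw [ha.map_eq hr _ h0 h1, map_sub, hconst σ x hσ, hconst _ x fun _ _ => rfl, sub_zero]

/-- The iterated cap product of the fundamental class with the classes of wall cocycles is
aspherical. -/
theorem exists_isAspherical_iterCap (m : ℕ) {Γ : Set (UnitAddTorus (Fin (m + 2)))}
    (hΓ : IsCompact Γ) (hdim : dimH Γ < 1)
    (oY : HomologyOrientation (Γᶜ : Set (UnitAddTorus (Fin (m + 2)))) (m + 2))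
    {Z : Type*} [TopologicalSpace Z] (f : C(Z, (Γᶜ : Set (UnitAddTorus (Fin (m + 2))))))
    (hf : IsProperMap f) {d : ℤ} (hd : d ≠ 0) {μZ : LFHomology Z (m + 2)}
    {μY : LFHomology (Γᶜ : Set (UnitAddTorus (Fin (m + 2)))) (m + 2)}
    (hμY : IsFundamentalClass oY μY) (hdeg : LFHomology.map f hf (m + 2) μZ = d • μY) :
    ∃ α : Fin m → H1 (UnitAddTorus (Fin (m + 2))),
      IsAspherical (iterCap m μZ fun i => H1.map ((torusIncl Γᶜ).comp f) (α i)) := by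
  obtain ⟨t, ε, hε, hΓε⟩ := exists_walls hΓ hdim
  set g := (torusIncl Γᶜ).comp f with hg
  let b : Fin (m + 2) → Cocycle1 Z := fun i =>
    ⟨pullCochain g (wallCochain t i), pullCochain_mem_cocycle _ (wallCochain_mem_cocycle t i)⟩
  refine ⟨fun i => QuotientAddGroup.mk
    (⟨wallCochain t (Fin.castAdd 2 i), wallCochain_mem_cocycle _ _⟩ : Cocycle1 _), ?_⟩
  change IsAspherical (iterCap m μZ fun i => QuotientAddGroup.mk (b (Fin.castAdd 2 i)))
  obtain ⟨a, ha⟩ := exists_lfRepresents (preimageCompacts f hf (wallNhd hΓε)) μZ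
  obtain ⟨a', ha', heval⟩ := ha.iterCap b
  have hdist : ∀ i, Continuous fun z => dist (g z i) (t i) := fun i =>
    ((continuous_apply i).comp g.continuous).dist continuous_const
  -- By naturality this is the value of all `m + 2` wall cocycles on `f_* a`, which is homologous to
  -- `d` times a representative of `[Y]` relative to the complement of the wall neighbourhood.
  have hne : evalCup 2 (fun i => (b (Fin.natAdd m i)).1) a' ≠ 0 := by
    rw [heval]
    change evalCup (m + 2) (fun i => pullCochain f
      (pullCochain (torusIncl Γᶜ) (wallCochain t i))) a ≠ 0
    rw [evalCup_pullCochain]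
    have h1 := ha.map f hf
    rw [hdeg] at h1
    obtain ⟨y, hy⟩ := exists_lfRepresents (wallNhd hΓε) μY
    have h2 := h1.represents_restrict (K := wallNhd hΓε) subset_rfl subset_rfl
    rw [map_zsmul] at h2
    have h3 := (hy.represents_restrict (K := wallNhd hΓε) subset_rfl subset_rfl).zsmul d
    rw [h2.map_eq h3 _ (fun c hc => evalCup_eq_zero _ 0 (fun e he => ?_) hc)
      (evalCup_boundary _ _ fun i => pullCochain_mem_cocycle _ (wallCochain_mem_cocycle t i)),
      map_zsmul]
    · exact smul_ne_zero hd (evalCup_wallCochain_ne_zero hε hΓε oY hμY hy)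
    · refine wallCochain_eq_zero t 0 _ ?_
      rintro _ ⟨s, rfl⟩ h
      refine he ⟨s, rfl⟩ ⟨0, ?_⟩
      change dist (((torusIncl Γᶜ).comp e) s 0) (t 0) ≤ ε
      rw [h, dist_self]
      exact hε.le
  have hsub : closure {z | ∃ i, dist (g z i) (t i) < ε} ⊆
      (preimageCompacts f hf (wallNhd hΓε) : Set Z) :=
    closure_minimal (fun z ⟨i, hi⟩ => ⟨i, hi.le⟩) <| by
      have h : (preimageCompacts f hf (wallNhd hΓε) : Set Z) =
          ⋃ i, {z | dist (g z i) (t i) ≤ ε} := by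
        ext z
        rw [Set.mem_iUnion]
        rfl
      rw [h]
      exact isClosed_iUnion_of_finite fun i => isClosed_le (hdist i) continuous_const
  -- `Ω` is the preimage of the open `ε`-neighbourhood of the walls. Its closure lies in the
  -- preimage of `wallNhd`, which is compact because `f` is proper.
  refine ⟨{z | ∃ i, dist (g z i) (t i) < ε}, ?_,
    (preimageCompacts f hf (wallNhd hΓε)).isCompact.of_isClosed_subset isClosed_closure hsub,
    fun hmem => hne ?_⟩
  · rw [Set.ofPred_exists]
    exact isOpen_iUnion fun i => isOpen_lt (hdist i) continuous_const
  · refine evalCup_eq_zero_of_mem_hurewiczImage _ (fun i => (b _).2) (fun e he => ?_) hmem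
      (ha'.represents_restrict hsub subset_closure)
    -- An edge outside `Ω` misses all walls, in particular that of the first of the two remaining
    -- cocycles.
    refine wallCochain_eq_zero t _ _ ?_
    rintro _ ⟨s, rfl⟩ h
    refine he ⟨s, rfl⟩ ⟨Fin.natAdd m 0, ?_⟩
    change dist ((g.comp e) s (Fin.natAdd m 0)) _ < ε
    rw [h, dist_self]
    exact hε

end

end SYS

theorem lemma5p6 (m : ℕ) (Γ : Set (UnitAddTorus (Fin (m + 2)))) (hΓ : IsCompact Γ)
    (hdim : dimH Γ < 1) (oY : SYS.HomologyOrientation (Γᶜ : Set (UnitAddTorus (Fin (m + 2)))) (m + 2))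
    (Z : Type*) [TopologicalSpace Z] [T2Space Z] [SecondCountableTopology Z]
    [ChartedSpace (EuclideanSpace ℝ (Fin (m + 2))) Z]
    (oZ : SYS.HomologyOrientation Z (m + 2))
    (f : C(Z, (Γᶜ : Set (UnitAddTorus (Fin (m + 2)))))) (hf : IsProperMap f)
    (d : ℤ) (hd : d ≠ 0) (hdeg : SYS.HasDegree oZ oY f hf d) :
    SYS.IsOpenSYS oZ ∧
      ∃ (μ : SYS.LFHomology Z (m + 2)) (α : Fin m → SYS.H1 (UnitAddTorus (Fin (m + 2)))),
        SYS.IsFundamentalClass oZ μ ∧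
        SYS.IsAspherical (SYS.iterCap m μ fun i =>
          SYS.H1.map ((⟨Subtype.val, continuous_subtype_val⟩ :
            C((Γᶜ : Set (UnitAddTorus (Fin (m + 2)))), UnitAddTorus (Fin (m + 2)))).comp f) (α i)) := by
  obtain ⟨μZ, μY, hZ, hY, h⟩ := hdeg
  obtain ⟨α, hα⟩ := SYS.exists_isAspherical_iterCap m hΓ hdim oY f hf hd hY h
  exact ⟨⟨μZ, _, hZ, hα⟩, μZ, α, hZ, hα⟩
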